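/- **Setting.** For $k>1$ and $0<\sigma\le\lambda$ let $\mathcal D(k,\lambda,\sigma)$ be the set of probability distributions $D$ on $\mathbb R$ with mean $\mu(D)\in[-\lambda,\lambda]$ and $\mathbb E_{X\sim D}|X-\mu(D)|^k\le\sigma^k$. A learner interacts sequentially with agents: in each round it chooses, adaptively and possibly at random, a threshold query $\mathbf 1\{x\le\gamma\}$ or $\mathbf 1\{x\ge\gamma\}$, and receives only its value at a fresh sample $X_t\sim D$ (all samples i.i.d. and independent of the learner's randomness). An estimator with output $\hat\mu$ is $(\epsilon,\delta)$-PAC for $\mathcal D$ if $\Pr(|\hat\mu-\mu(D)|\le\epsilon)\ge1-\delta$ for every $D\in\mathcal D$. **Estimator for a known scale**, with parameters $(k,\lambda,\sigma,\epsilon,\delta)$; put $\kappa=\min(k,3)$. (1) A localization procedure uses $O(1+\log\frac\lambda\sigma+\log\frac1\delta)$ threshold queries and returns $L,U$ such that for all $D\in\mathcal D(k,\lambda,\sigma)$, with probability at least $1-\delta/2$, every median of $D$ is in $[L,U]$ and $[L-\sigma,U+\sigma]$ has length at most $8\sigma$. Let $c=(L+U)/2$. (2) Let $t=A\,\sigma(\sigma/\epsilon)^{1/(\kappa-1)}$,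 $i_{\max}=\lceil\log_2(t/\sigma)\rceil$, $m_0=0$, $m_i=2^i$ for $i\ge1$, and for $1\le i\le i_{\max}$ consider the regions $[a,b)=[m_{i-1}\sigma,m_i\sigma)$ and $[a,b)=[-m_i\sigma,-m_{i-1}\sigma)$, with $n_i=\lceil B(\sigma/\epsilon)^2 2^{i(2-\kappa)}\rceil$. (3) For each region estimate $\mathbb E[(X-c)\mathbf 1\{X-c\in[a,b)\}]$ by $a\hat p_a+b\hat p_b$, where $\hat p_a,\hat p_b$ estimate $p_a=\Pr(X-c\ge a)-\Pr(X-c\ge T)$ and $p_b=\Pr(X-c<b)-\Pr(X-c\le T)$, with $T\sim\mathrm{Unif}(a,b)$ fresh for each query, each of the four probabilities being replaced by the empirical frequency in $n_i$ threshold queries on fresh samples; the sum over all regions is a base estimate. (4) Output $c$ plus the median of $\lceil8\log(2/\delta)\rceil$ independent base estimates. **Scale-adaptive estimator**, with parameters $k,\lambda,\sigma_{\min}\le\sigma_{\max}\le\lambda$, $r,\delta\in(0,1)$. Let $T=\lceil\log_2(\sigma_{\max}/\sigma_{\min})\rceil$, $\sigma_i=\sigma_{\max}2^{-i}$, $\epsilon_i=r\sigma_i/6$.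 In rounds $i=0,1,\dots,T$ run the estimator above on fresh samples with parameters $(k,\lambda,\sigma_i,\epsilon_i,\delta/(T+1))$; let $\hat\mu^{(i)}$ be its output and $I_i=[\hat\mu^{(i)}-\epsilon_i,\hat\mu^{(i)}+\epsilon_i]$. Stop at the first $i$ such that $I_i\cap I_l=\emptyset$ for some $l<i$ and output $\hat\mu^{(i-1)}$; if there is no such $i\le T$, output $\hat\mu^{(T)}$. **Theorem.** There is a localization procedure as in (1), and for every $k>1$ there are constants $A,B,C>0$ depending only on $k$, such that for all $0<\sigma_{\min}\le\sigma_{\max}\le\lambda$, $r\in(0,1)$ and $\delta\in(0,1)$: for every $\sigma_{\mathrm{true}}\in[\sigma_{\min},\sigma_{\max}]$ the scale-adaptive estimator (which does not depend on $\sigma_{\mathrm{true}}$) is $(r\sigma_{\mathrm{true}},\delta)$-PAC for $\mathcal D(k,\lambda,\sigma_{\mathrm{true}})$, and the number of samples that it uses is always at most $$C\cdot\mathrm{Log}\Big(\frac{\sigma_{\max}}{\sigma_{\min}}\Big)\left(S_k(r)\cdot\mathrm{Log}\Big(\frac{\mathrm{Log}(\sigma_{\max}/\sigma_{\min})}{\delta}\Big)+\log\frac{\lambda}{\sqrt{\sigma_{\min}\sigma_{\max}}}\right),$$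 where $\mathrm{Log}(x)=\max\{1,\log x\}$ and $S_k(r)=r^{-2}$ if $k>2$, $S_2(r)=r^{-2}\,\mathrm{Log}(1/r)$, and $S_k(r)=r^{-k/(k-1)}$ if $1<k<2$. -/

import Mathlib

open MeasureTheory Set
open scoped ENNReal

noncomputable section

/-! ### Threshold queries and interactive protocols -/

/-- A threshold query: `1{x ≤ γ}` or `1{x ≥ γ}`. -/
inductive ThresholdQuery : Type
  | le (γ : ℝ)
  | ge (γ : ℝ)

/-- The one-bit answer of an agent that holds the sample `x`. -/
def ThresholdQuery.answer : ThresholdQuery → ℝ → Bool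
  | .le γ, x => decide (x ≤ γ)
  | .ge γ, x => decide (γ ≤ x)

/-- A randomized, adaptive one-bit protocol with threshold queries and with output in `α`.
Either the learner stops and outputs a value, or it draws a fresh `u` from the uniform distribution
on `[0, 1]`, sends the query `q u` to an agent holding a fresh sample, and continues in a way that
depends on `u` and on the received bit (and, through the position in the tree, on the history). -/
inductive Protocol (α : Type) : Type
  | ret (a : α) : Protocol α
  | ask (q : unitInterval → ThresholdQuery) (next : unitInterval → Bool → Protocol α) : Protocol α

namespace Protocol

variable {α β ι : Type}

/-- Sequential composition of protocols. -/
def bind : Protocol α → (α → Protocol β) → Protocol β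
  | ret a, f => f a
  | ask q next, f => ask q (fun u y => (next u y).bind f)

/-- Run a protocol on a data stream: in round `t` the agent holds the sample `(ω t).1` and the
learner's internal randomness is `(ω t).2`. The result is the output together with the number of
samples that were used. -/
def run : Protocol α → (ℕ → ℝ × unitInterval) → α × ℕ
  | ret a, _ => (a, 0)
  | ask q next, ω =>
    let res := (next (ω 0).2 ((q (ω 0).2).answer (ω 0).1)).run (fun t => ω (t + 1))
    (res.1, res.2 + 1)

/-- The output of the learner. -/
def output (p : Protocol α) (ω : ℕ → ℝ × unitInterval) : α := (p.run ω).1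

/-- The number of samples used. -/
def samples (p : Protocol α) (ω : ℕ → ℝ × unitInterval) : ℕ := (p.run ω).2

/-- Run `p` independently `n` times and list the outputs. -/
def replicate (p : Protocol α) : ℕ → Protocol (List α)
  | 0 => ret []
  | n + 1 => p.bind fun a => (p.replicate n).bind fun l => ret (a :: l)

/-- Run `f i` for all entries `i` of a list, and add up the outputs. -/
def sumOver (f : ι → Protocol ℝ) : List ι → Protocol ℝ
  | [] => ret 0
  | i :: l => (f i).bind fun x => (sumOver f l).bind fun s => ret (x + s)

/-- A single (possibly randomized) threshold query, returning the received bit. -/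
def askOnce (q : unitInterval → ThresholdQuery) : Protocol Bool := ask q fun _ y => ret y

/-- The fraction of positive answers in `n` independent repetitions of a threshold query. -/
def frequency (q : unitInterval → ThresholdQuery) (n : ℕ) : Protocol ℝ :=
  ((askOnce q).replicate n).bind fun l => ret ((l.count true : ℝ) / n)

end Protocol

/-- The law of the data stream: i.i.d. samples from `D` and, independently of them, i.i.d. uniform
random variables for the internal randomness of the learner. -/
def streamLaw (D : Measure ℝ) : Measure (ℕ → ℝ × unitInterval) :=
  Measure.infinitePi fun _ : ℕ => D.prod (volume : Measure unitInterval)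

/-! ### The distribution family and the accuracy guarantee -/

/-- The mean of a distribution on the real line. -/
def distMean (D : Measure ℝ) : ℝ := ∫ x, x ∂D

/-- The family of all distributions with mean in `[-lam, lam]` and `k`-th central moment at most
`σ ^ k`. -/
structure InFamily (k lam σ : ℝ) (D : Measure ℝ) : Prop where
  isProbabilityMeasure : IsProbabilityMeasure D
  integrable : Integrable (fun x : ℝ => x) D
  abs_mean_le : |distMean D| ≤ lam
  moment_integrable : Integrable (fun x : ℝ => |x - distMean D| ^ k) D
  moment_le : ∫ x, |x - distMean D| ^ k ∂D ≤ σ ^ k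

/-- The estimator `p` is `ε`-correct with probability at least `1 - δ` for every distribution in the
family. (Bounding the outer measure of the failure event is the stronger form, should the event not
be measurable.) -/
def IsPAC (p : Protocol ℝ) (ε δ : ℝ) (family : Measure ℝ → Prop) : Prop :=
  ∀ D : Measure ℝ, family D →
    streamLaw D {ω | ε < |p.output ω - distMean D|} ≤ ENNReal.ofReal δ

/-! ### The estimator for a known scale -/

/-- `m` is a median of `D`. -/
def IsMedian (D : Measure ℝ) (m : ℝ) : Prop :=
  1 / 2 ≤ D (Iic m) ∧ 1 / 2 ≤ D (Ici m)

/-- A localization procedure: for all `lam`, `σ`, `δ` it uses `O(log (lam / σ) + log (1 / δ))`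
threshold queries and returns the end points `L`, `U` of an interval which, with probability at
least `1 - δ / 2`, contains the median and is such that `[L - σ, U + σ]` has length at most
`8 σ`. -/
def IsLocalizer (loc : ℝ → ℝ → ℝ → Protocol (ℝ × ℝ)) : Prop :=
  ∃ C : ℝ, 0 < C ∧ ∀ lam σ δ : ℝ, 0 < σ → σ ≤ lam → 0 < δ → δ < 1 →
    (∀ ω, ((loc lam σ δ).samples ω : ℝ) ≤ C * (1 + Real.log (lam / σ) + Real.log (1 / δ))) ∧
    ∀ k : ℝ, 1 < k → ∀ D : Measure ℝ, InFamily k lam σ D →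
      streamLaw D {ω | ¬ ((∀ m, IsMedian D m → m ∈ Icc ((loc lam σ δ).output ω).1
          ((loc lam σ δ).output ω).2) ∧
        ((loc lam σ δ).output ω).2 + σ - (((loc lam σ δ).output ω).1 - σ) ≤ 8 * σ)}
        ≤ ENNReal.ofReal (δ / 2)

/-- The grid `m₀ = 0`, `mᵢ = 2 ^ i` for `i ≥ 1`. -/
def gridPoint (i : ℕ) : ℝ := if i = 0 then 0 else 2 ^ i

/-- Estimate of `E[(X - c) 1{X - c ∈ [a, b)}]` from `4 n` threshold queries.
With `T` uniform on `(a, b)`, this mean equals `a * p_a + b * p_b`, where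
`p_a = P(X - c ≥ a) - P(X - c ≥ T)` and `p_b = P(X - c < b) - P(X - c ≤ T)`; the probability
`P(X - c < b)` is estimated by negating the answers to the query `1{X - c ≥ b}`. -/
def localEstimate (c a b : ℝ) (n : ℕ) : Protocol ℝ :=
  (Protocol.frequency (fun _ => .ge (c + a)) n).bind fun f₁ =>
  (Protocol.frequency (fun u => .ge (c + (a + (b - a) * (u : ℝ)))) n).bind fun f₂ =>
  (Protocol.frequency (fun _ => .ge (c + b)) n).bind fun f₃ =>
  (Protocol.frequency (fun u => .le (c + (a + (b - a) * (u : ℝ)))) n).bind fun f₄ =>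
  .ret (a * (f₁ - f₂) + b * ((1 - f₃) - f₄))

/-- The cutoff threshold `t = A σ (σ / ε) ^ (1 / (k - 1))`. -/
def cutoff (A k σ ε : ℝ) : ℝ := A * (σ * (σ / ε) ^ (1 / (k - 1)))

/-- The number of regions on each side: the least `i` with `2 ^ i * σ ≥ t`. -/
def numRegions (A k σ ε : ℝ) : ℕ := ⌈Real.logb 2 (cutoff A k σ ε / σ)⌉₊

/-- The number of queries of each type in the regions `±i`, of order
`(σ / ε) ^ 2 * 2 ^ (i (2 - k))`. -/
def allocation (B k σ ε : ℝ) (i : ℕ) : ℕ := ⌈B * ((σ / ε) ^ 2 * (2 : ℝ) ^ ((i : ℝ) * (2 - k)))⌉₊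

/-- The base estimator of the clipped mean of `X - c`: the sum of the local estimates over the
regions `[mᵢ₋₁ σ, mᵢ σ)` and `[-mᵢ σ, -mᵢ₋₁ σ)` for `i = 1, …, numRegions`. -/
def baseEstimate (A B k σ ε c : ℝ) : Protocol ℝ :=
  Protocol.sumOver (fun j : ℕ =>
    (localEstimate c (gridPoint j * σ) (gridPoint (j + 1) * σ) (allocation B k σ ε (j + 1))).bind
      fun x =>
    (localEstimate c (-(gridPoint (j + 1) * σ)) (-(gridPoint j * σ))
      (allocation B k σ ε (j + 1))).bind fun y =>
    .ret (x + y)) (List.range (numRegions A k σ ε))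

/-- The median of a nonempty list of reals (the average of the two middle entries if the length is
even). -/
def listMedian (l : List ℝ) : ℝ :=
  ((l.insertionSort (· ≤ ·)).getD ((l.length - 1) / 2) 0 +
    (l.insertionSort (· ≤ ·)).getD (l.length / 2) 0) / 2

/-- The mean estimator with parameters `k`, `lam`, `σ`, `ε`, `δ`: localize the mean, center at the
mid-point `c` of the localized interval, and return `c` plus the median of `⌈8 log (2 / δ)⌉`
independent base estimates for `X - c`. For `k > 3` the moment parameter `3` is used. The numbers
`A` and `B` are the constants hidden in the orders of magnitude of the cutoff and of the sample
allocation. -/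
def meanEstimator (loc : ℝ → ℝ → ℝ → Protocol (ℝ × ℝ)) (A B k lam σ ε δ : ℝ) : Protocol ℝ :=
  (loc lam σ δ).bind fun LU =>
  ((baseEstimate A B (min k 3) σ ε ((LU.1 + LU.2) / 2)).replicate
    ⌈8 * Real.log (2 / δ)⌉₊).bind fun l =>
  .ret ((LU.1 + LU.2) / 2 + listMedian l)

/-! ### Grid search over the scale -/

/-- The sequential search. `est i` produces the estimate of round `i`, whose confidence interval is
`[μᵢ - eps i, μᵢ + eps i]`. At most `n` more rounds are run, starting with round `i`; `prev` lists
the intervals (mid-point and half-width) of the earlier rounds, and `last` is the estimate of the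
last successful round. The search stops as soon as the new interval is disjoint from one of the
earlier intervals, and outputs the last successful estimate. -/
def gridLoop (est : ℕ → Protocol ℝ) (eps : ℕ → ℝ) :
    ℕ → ℕ → List (ℝ × ℝ) → ℝ → Protocol ℝ
  | 0, _, _, last => .ret last
  | n + 1, i, prev, last => (est i).bind fun x =>
      open Classical in
      if ∃ J ∈ prev, Icc (x - eps i) (x + eps i) ∩ Icc (J.1 - J.2) (J.1 + J.2) = ∅ then
        .ret last
      else gridLoop est eps n (i + 1) ((x, eps i) :: prev) x

/-- The index `T = ⌈log₂ (σmax / σmin)⌉` of the last grid point. -/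
def lastIndex (σmin σmax : ℝ) : ℕ := ⌈Real.logb 2 (σmax / σmin)⌉₊

/-- The guessed scale `σᵢ = σmax / 2 ^ i`. -/
def guess (σmax : ℝ) (i : ℕ) : ℝ := σmax / 2 ^ i

/-- The scale-adaptive estimator: grid search over the scales `σ₀, …, σ_T`, where round `i` runs the
mean estimator with parameters `εᵢ = r σᵢ / 6`, `δᵢ = δ / (T + 1)`, `lam`, `σᵢ`. (Round `0` always
succeeds, so the initial value `0` of the running output is never returned.) -/
def scaleAdaptiveEstimator (loc : ℝ → ℝ → ℝ → Protocol (ℝ × ℝ)) (A B k lam σmin σmax r δ : ℝ) :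
    Protocol ℝ :=
  gridLoop
    (fun i => meanEstimator loc A B k lam (guess σmax i) (r * guess σmax i / 6)
      (δ / (lastIndex σmin σmax + 1)))
    (fun i => r * guess σmax i / 6)
    (lastIndex σmin σmax + 1) 0 [] 0

/-! ### The sample complexity -/

/-- `max {1, log x}`: the logarithm as it is read in an order of magnitude. -/
def logPlus (x : ℝ) : ℝ := max 1 (Real.log x)

/-- The dependence `S_k(r)` of the sample complexity on the relative accuracy. -/
def refinementRate (k r : ℝ) : ℝ :=
  if 2 < k then 1 / r ^ 2
  else if k = 2 then 1 / r ^ 2 * logPlus (1 / r)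
  else (1 / r) ^ (k / (k - 1))

/-- `log (σmax / σmin) * (S_k(r) * log (log (σmax / σmin) / δ) + log (lam / √(σmin σmax)))`. -/
def scaleAdaptiveComplexity (k lam σmin σmax r δ : ℝ) : ℝ :=
  logPlus (σmax / σmin) *
    (refinementRate k r * logPlus (logPlus (σmax / σmin) / δ) +
      Real.log (lam / Real.sqrt (σmin * σmax)))

end

/-! Some guess σ_m lies between σ_true and 2 σ_true. In rounds 0, ..., m the guess is an upper bound
for the scale, so the known-scale estimator is valid there; with probability at least 1 - δ all
these intervals contain the mean, hence they meet and the search survives round m. Later rounds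
carry no guarantee and need none: an estimate accepted later has an interval, no longer than that of
round m, which meets that of round m. So it is within 3 ε_m = r σ_m / 2 ≤ r σ_true of the mean
(`gridLoop_always`, `prob_gridLoop_le`).

For a known scale (`prob_baseEstimate_le`, `prob_meanEstimator_le`), a base estimate has mean E[(X -
c) 1{|X - c| < m}], up to the end points, where m is the largest grid point times σ. The truncation
bias is at most E|X - c|^κ / m^(κ-1), which the cutoff makes at most ε / 2. A region at distance
about 2^i σ contributes a variance of order (2^i σ)² P(|X - c| ≥ 2^(i-1) σ) / n_i. The choice of n_i
turns the sum of these into ε² / B times a sum of 2^(iκ) P(|X - c| ≥ 2^(i-1) σ), which the κ-th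
moment bounds. Chebyshev gives failure probability 1/4, and the median of independent runs makes it
exponentially small.

Localization needs O(log(lam / σ) + log(1 / δ)) queries with noisy answers. A binary search that
backtracks by enlarging its interval has a potential whose expectation contracts unless the interval
is short and near the target (`expect_locPotential_locStep_le`). Hence most visited midpoints are
good and their median is a coarse estimate (`prob_listMedian_locWalk_le`). Majority votes on a grid
of constant size then give an error of at most 2 σ (`prob_locRefine_le`).

All protocols involved use the internal randomness only to form the current query. Their output laws
therefore obey a recursion over the protocol tree (`expect`, `streamLaw_output`), so unions of
failures, means and variances are handled algebraically. Sample counts are worst-case bounds along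
all branches (`UsesAtMost`). -/

/-! ### The law of the stream after the first round -/

/-- Prepend a first round to a data stream. -/
def streamCons {Z : Type} (z : Z) (ω : ℕ → Z) : ℕ → Z
  | 0 => z
  | n + 1 => ω n

/-- A product measure is determined by its values on finite boxes, and a box of glued streams is a
condition on the first entry times the shifted box for the rest. -/
theorem map_streamCons_prod_infinitePi {Z : Type} [MeasurableSpace Z] (ν : Measure Z)
    [IsProbabilityMeasure ν] :
    (ν.prod (Measure.infinitePi fun _ : ℕ => ν)).map (fun p => streamCons p.1 p.2) =
      Measure.infinitePi fun _ : ℕ => ν := by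
  have hmeas : Measurable (fun p : Z × (ℕ → Z) => streamCons p.1 p.2) := by
    refine measurable_pi_lambda _ fun n => ?_
    cases n with
    | zero => exact measurable_fst
    | succ n => exact (measurable_pi_apply n).comp measurable_snd
  refine Measure.eq_infinitePi (fun _ : ℕ => ν) fun s t ht => ?_
  have hs : MeasurableSet (Set.pi (s : Set ℕ) t) :=
    MeasurableSet.pi s.countable_toSet fun i _ => ht i
  rw [Measure.map_apply hmeas hs]
  let s' : Finset ℕ := s.preimage Nat.succ (Nat.succ_injective.injOn)
  have hpre : (fun p : Z × (ℕ → Z) => streamCons p.1 p.2) ⁻¹' (Set.pi (s : Set ℕ) t) =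
      (if 0 ∈ s then t 0 else univ) ×ˢ (Set.pi (s' : Set ℕ) fun i => t (i + 1)) := by
    ext ⟨z, ω⟩
    simp only [mem_preimage, Set.mem_pi, mem_prod, Finset.mem_coe]
    constructor
    · intro h
      refine ⟨?_, fun i hi => h (i + 1) (by simpa [s'] using hi)⟩
      split_ifs with h0
      · exact h 0 h0
      · trivial
    · rintro ⟨h0, h1⟩ i hi
      cases i with
      | zero => simpa [hi, streamCons] using h0
      | succ i => exact h1 i (by simpa [s'] using hi)
  rw [hpre, Measure.prod_prod, Measure.infinitePi_pi _ (fun i _ => ht (i + 1))]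
  have hprod : ∏ i ∈ s', ν (t (i + 1)) = ∏ i ∈ s.erase 0, ν (t i) := by
    refine Finset.prod_bij (fun i _ => i + 1) (fun i hi => ?_) (fun i _ j _ h => by simpa using h)
      (fun j hj => ?_) (fun _ _ => rfl)
    · simpa [s'] using hi
    · obtain ⟨h0, hj⟩ := Finset.mem_erase.1 hj
      obtain ⟨i, rfl⟩ := Nat.exists_eq_succ_of_ne_zero h0
      exact ⟨i, by simpa [s'] using hj, rfl⟩
  rw [hprod]
  split_ifs with h0
  · exact Finset.mul_prod_erase s (fun i => ν (t i)) h0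
  · rw [measure_univ, one_mul, Finset.erase_eq_of_notMem h0]

/-- Independence of the first round from the later ones; this justifies the recursion over the
protocol tree. -/
theorem streamLaw_prod_preimage (D : Measure ℝ) [IsProbabilityMeasure D]
    {Q : Set (ℝ × unitInterval)} (hQ : MeasurableSet Q)
    {S : Set (ℕ → ℝ × unitInterval)} (hS : MeasurableSet S) :
    streamLaw D {ω | ω 0 ∈ Q ∧ (fun t => ω (t + 1)) ∈ S} =
      (D.prod (volume : Measure unitInterval)) Q * streamLaw D S := by
  have hmeas : Measurable (fun p : (ℝ × unitInterval) × (ℕ → ℝ × unitInterval) =>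
      streamCons p.1 p.2) := by
    refine measurable_pi_lambda _ fun n => ?_
    cases n with
    | zero => exact measurable_fst
    | succ n => exact (measurable_pi_apply n).comp measurable_snd
  have hshift : Measurable (fun (ω : ℕ → ℝ × unitInterval) (t : ℕ) => ω (t + 1)) :=
    measurable_pi_lambda _ fun n => measurable_pi_apply (n + 1)
  have hset : MeasurableSet {ω : ℕ → ℝ × unitInterval | ω 0 ∈ Q ∧ (fun t => ω (t + 1)) ∈ S} :=
    (measurable_pi_apply 0 hQ).inter (hshift hS)
  unfold streamLaw at *
  conv_lhs => rw [← map_streamCons_prod_infinitePi, Measure.map_apply hmeas hset]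
  rw [← Measure.prod_prod]
  rfl

/-! ### Expectations of the output of a protocol -/

/-- The probability that a randomized threshold query is answered positively. -/
noncomputable def askProb (D : Measure ℝ) (q : unitInterval → ThresholdQuery) : ℝ :=
  (D.prod (volume : Measure unitInterval)).real {z | (q z.2).answer z.1 = true}

theorem askProb_nonneg (D : Measure ℝ) (q : unitInterval → ThresholdQuery) : 0 ≤ askProb D q :=
  measureReal_nonneg

theorem askProb_le_one (D : Measure ℝ) [IsProbabilityMeasure D]
    (q : unitInterval → ThresholdQuery) : askProb D q ≤ 1 :=
  measureReal_le_one

namespace Protocol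

variable {α β ι : Type}

/-- The expectation of `f` at the output of a protocol whose continuations do not depend on the
internal randomness (see `Oblivious`). -/
noncomputable def expect (D : Measure ℝ) : Protocol α → (α → ℝ) → ℝ
  | ret a, f => f a
  -- The argument `0` is an arbitrary representative: under `Oblivious` all values of `u` give the
  -- same continuation.
  | ask q next, f => askProb D q * (next 0 true).expect D f +
      (1 - askProb D q) * (next 0 false).expect D f

/-- All queries are measurable, and the continuations do not depend on the internal randomness. -/
def Oblivious : Protocol α → Prop
  | ret _ => True
  | ask q next => MeasurableSet {z : ℝ × unitInterval | (q z.2).answer z.1 = true} ∧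
      (∀ u y, next u y = next 0 y) ∧ ∀ u y, (next u y).Oblivious

/-- All possible outputs satisfy `Q`. -/
def Always (Q : α → Prop) : Protocol α → Prop
  | ret a => Q a
  | ask _ next => ∀ u y, (next u y).Always Q

@[simp] theorem ret_bind (a : α) (f : α → Protocol β) : (ret a).bind f = f a := rfl

theorem bind_assoc {γ : Type} (p : Protocol α) (f : α → Protocol β) (g : β → Protocol γ) :
    (p.bind f).bind g = p.bind fun a => (f a).bind g := by
  induction p with
  | ret a => rfl
  | ask q next ih => simp [bind, ih]

theorem Oblivious.bind {p : Protocol α} {f : α → Protocol β} (hp : p.Oblivious)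
    (hf : ∀ a, (f a).Oblivious) : (p.bind f).Oblivious := by
  induction p with
  | ret a => exact hf a
  | ask q next ih =>
    obtain ⟨h1, h2, h3⟩ := hp
    exact ⟨h1, fun u y => congrArg (fun p => p.bind f) (h2 u y), fun u y => ih u y (h3 u y)⟩

theorem Oblivious.replicate {p : Protocol α} (hp : p.Oblivious) (n : ℕ) :
    (p.replicate n).Oblivious := by
  induction n with
  | zero => trivial
  | succ n ih => exact hp.bind fun a => ih.bind fun l => trivial

theorem Oblivious.sumOver {f : ι → Protocol ℝ} (hf : ∀ i, (f i).Oblivious) (l : List ι) :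
    (sumOver f l).Oblivious := by
  induction l with
  | nil => trivial
  | cons i l ih => exact (hf i).bind fun x => ih.bind fun s => trivial

theorem Always.bind {Q : α → Prop} {R : β → Prop} {p : Protocol α} {f : α → Protocol β}
    (hp : p.Always Q) (hf : ∀ a, Q a → (f a).Always R) : (p.bind f).Always R := by
  induction p with
  | ret a => exact hf a hp
  | ask q next ih => exact fun u y => ih u y (hp u y)

theorem always_of_forall {Q : α → Prop} (h : ∀ a, Q a) (p : Protocol α) : p.Always Q := by
  induction p with
  | ret a => exact h a
  | ask q next ih => exact fun u y => ih u y

theorem replicate_always_length (p : Protocol α) (n : ℕ) :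
    (p.replicate n).Always fun l => l.length = n := by
  induction n with
  | zero => rfl
  | succ n ih =>
    refine (always_of_forall (Q := fun _ => True) (fun _ => trivial) p).bind fun a _ => ?_
    exact ih.bind fun l hl => by simp [Always, hl]

theorem expect_bind (D : Measure ℝ) (p : Protocol α) (f : α → Protocol β) (g : β → ℝ) :
    (p.bind f).expect D g = p.expect D fun a => (f a).expect D g := by
  induction p with
  | ret a => rfl
  | ask q next ih => simp [bind, expect, ih]

theorem expect_add (D : Measure ℝ) (p : Protocol α) (f g : α → ℝ) :
    (p.expect D fun a => f a + g a) = p.expect D f + p.expect D g := by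
  induction p with
  | ret a => rfl
  | ask q next ih => simp only [expect, ih]; ring

theorem expect_const_mul (D : Measure ℝ) (p : Protocol α) (c : ℝ) (f : α → ℝ) :
    (p.expect D fun a => c * f a) = c * p.expect D f := by
  induction p with
  | ret a => rfl
  | ask q next ih => simp only [expect, ih]; ring

theorem expect_const (D : Measure ℝ) (p : Protocol α) (c : ℝ) : (p.expect D fun _ => c) = c := by
  induction p with
  | ret a => rfl
  | ask q next ih => simp only [expect, ih]; ring

/-- The probability that the output of a protocol lies in `S`. -/
noncomputable def prob (D : Measure ℝ) (p : Protocol α) (S : Set α) : ℝ :=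
  p.expect D (S.indicator 1)

theorem prob_bind_ret (D : Measure ℝ) (p : Protocol α) (f : α → β) (T : Set β) :
    (p.bind fun a => ret (f a)).prob D T = p.prob D (f ⁻¹' T) := by
  rw [prob, expect_bind]; rfl

/-! ### Probabilities of output events, and their transfer to the data stream. -/

section Prob

variable (D : Measure ℝ) [IsProbabilityMeasure D]

theorem expect_mono_of_always {p : Protocol α} {Q : α → Prop} (hp : p.Always Q) {f g : α → ℝ}
    (h : ∀ a, Q a → f a ≤ g a) : p.expect D f ≤ p.expect D g := by
  induction p with
  | ret a => exact h a hp
  | ask q next ih =>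
    have h1 := askProb_nonneg D q
    have h2 := askProb_le_one D q
    exact add_le_add (mul_le_mul_of_nonneg_left (ih 0 true (hp 0 true)) h1)
      (mul_le_mul_of_nonneg_left (ih 0 false (hp 0 false)) (by linarith))

theorem expect_mono (p : Protocol α) {f g : α → ℝ} (h : ∀ a, f a ≤ g a) :
    p.expect D f ≤ p.expect D g :=
  expect_mono_of_always D (always_of_forall (Q := fun _ => True) (fun _ => trivial) p)
    fun a _ => h a

theorem expect_nonneg (p : Protocol α) {f : α → ℝ} (h : ∀ a, 0 ≤ f a) : 0 ≤ p.expect D f := by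
  simpa [expect_const] using expect_mono D p h

theorem prob_nonneg (p : Protocol α) (S : Set α) : 0 ≤ p.prob D S :=
  expect_nonneg D p fun a => indicator_nonneg (by simp) a

theorem prob_le_one (p : Protocol α) (S : Set α) : p.prob D S ≤ 1 := by
  have := expect_mono D p (f := S.indicator 1) (g := fun _ => 1)
    (fun a => indicator_le_self' (by simp) a)
  rw [expect_const] at this
  exact this

theorem prob_mono_of_always {p : Protocol α} {Q : α → Prop} (hp : p.Always Q) {S T : Set α}
    (h : ∀ a, Q a → a ∈ S → a ∈ T) : p.prob D S ≤ p.prob D T := by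
  refine expect_mono_of_always D hp fun a ha => ?_
  by_cases hS : a ∈ S
  · simp [hS, h a ha hS]
  · simpa [hS] using indicator_nonneg (by simp) a

theorem prob_mono (p : Protocol α) {S T : Set α} (h : S ⊆ T) : p.prob D S ≤ p.prob D T :=
  prob_mono_of_always D (always_of_forall (Q := fun _ => True) (fun _ => trivial) p)
    fun _ _ ha => h ha

theorem prob_eq_zero_of_always {p : Protocol α} {Q : α → Prop} (hp : p.Always Q) {S : Set α}
    (h : ∀ a, Q a → a ∉ S) : p.prob D S = 0 := by
  refine le_antisymm ?_ (prob_nonneg D p S)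
  calc p.prob D S ≤ p.prob D ∅ := prob_mono_of_always D hp fun a ha hS => h a ha hS
    _ = 0 := by simpa [prob, indicator_empty] using expect_const D p 0

/-- Union bound along a composition: the output of `p` is in `S`, or the rest fails. -/
theorem prob_bind_le (p : Protocol α) (f : α → Protocol β) (S : Set α) (T : Set β) {e : ℝ}
    (he : 0 ≤ e) (h : ∀ a, a ∉ S → (f a).prob D T ≤ e) :
    (p.bind f).prob D T ≤ p.prob D S + e := by
  rw [prob, expect_bind]
  calc _ ≤ p.expect D fun a => S.indicator 1 a + e := by
        refine expect_mono D p fun a => ?_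
        by_cases ha : a ∈ S
        · rw [indicator_of_mem ha]
          exact (prob_le_one D (f a) T).trans (le_add_of_nonneg_right he)
        · rw [indicator_of_notMem ha, zero_add]
          exact h a ha
    _ = _ := by rw [expect_add, expect_const]; rfl

/-- Markov's inequality. -/
theorem mul_prob_le_expect (p : Protocol α) {f : α → ℝ} (hf : ∀ a, 0 ≤ f a) {S : Set α} {c : ℝ}
    (h : ∀ a ∈ S, c ≤ f a) : c * p.prob D S ≤ p.expect D f := by
  rw [prob, ← expect_const_mul]
  refine expect_mono D p fun a => ?_
  by_cases ha : a ∈ S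
  · simpa [ha] using h a ha
  · simpa [ha] using hf a

theorem measurableSet_output {p : Protocol α} (hp : p.Oblivious) (S : Set α) :
    MeasurableSet {ω | p.output ω ∈ S} := by
  induction p with
  | ret a => exact MeasurableSet.const (a ∈ S)
  | ask q next ih =>
    obtain ⟨h1, h2, h3⟩ := hp
    have hshift : Measurable (fun (ω : ℕ → ℝ × unitInterval) (t : ℕ) => ω (t + 1)) :=
      measurable_pi_lambda _ fun n => measurable_pi_apply (n + 1)
    have hset : {ω | (ask q next).output ω ∈ S} =
        ({ω | ω 0 ∈ {z : ℝ × unitInterval | (q z.2).answer z.1 = true}} ∩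
          (fun (ω : ℕ → ℝ × unitInterval) (t : ℕ) => ω (t + 1)) ⁻¹'
            {ω | (next 0 true).output ω ∈ S}) ∪
        ({ω | ω 0 ∈ {z : ℝ × unitInterval | (q z.2).answer z.1 = true}ᶜ} ∩
          (fun (ω : ℕ → ℝ × unitInterval) (t : ℕ) => ω (t + 1)) ⁻¹'
            {ω | (next 0 false).output ω ∈ S}) := by
      ext ω
      simp only [output, run, mem_ofPred_eq, mem_union, mem_inter_iff, mem_preimage, mem_compl_iff]
      rw [h2]
      cases (q (ω 0).2).answer (ω 0).1 <;> simp
    rw [hset]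
    exact ((measurable_pi_apply 0 h1).inter (hshift (ih 0 true (h3 0 true)))).union
      ((measurable_pi_apply 0 h1.compl).inter (hshift (ih 0 false (h3 0 false))))

/-- The law of the output of an oblivious protocol. -/
theorem streamLaw_output {p : Protocol α} (hp : p.Oblivious) (S : Set α) :
    streamLaw D {ω | p.output ω ∈ S} = ENNReal.ofReal (p.prob D S) := by
  induction p with
  | ret a =>
    have : IsProbabilityMeasure (streamLaw D) := by unfold streamLaw; infer_instance
    by_cases ha : a ∈ S <;> simp [output, run, prob, expect, ha]
  | ask q next ih =>
    obtain ⟨h1, h2, h3⟩ := hp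
    set Q := {z : ℝ × unitInterval | (q z.2).answer z.1 = true} with hQ
    -- The first answer splits the event into two disjoint ones, each a condition on round one and a
    -- condition on the shifted stream.
    have hset : {ω | (ask q next).output ω ∈ S} =
        {ω | ω 0 ∈ Q ∧ (fun t => ω (t + 1)) ∈ {ω | (next 0 true).output ω ∈ S}} ∪
        {ω | ω 0 ∈ Qᶜ ∧ (fun t => ω (t + 1)) ∈ {ω | (next 0 false).output ω ∈ S}} := by
      ext ω
      simp only [output, run, mem_ofPred_eq, mem_union, mem_compl_iff, hQ]
      rw [h2]
      cases (q (ω 0).2).answer (ω 0).1 <;> simp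
    have hshift : Measurable (fun (ω : ℕ → ℝ × unitInterval) (t : ℕ) => ω (t + 1)) :=
      measurable_pi_lambda _ fun n => measurable_pi_apply (n + 1)
    have hm := measurableSet_output (h3 0 false) S
    have hm' : MeasurableSet {ω : ℕ → ℝ × unitInterval | ω 0 ∈ Qᶜ ∧
        (fun t => ω (t + 1)) ∈ {ω | (next 0 false).output ω ∈ S}} :=
      (measurable_pi_apply (X := fun _ : ℕ => ℝ × unitInterval) 0 h1.compl).inter (hshift hm)
    have hdisj : Disjoint
        {ω : ℕ → ℝ × unitInterval | ω 0 ∈ Q ∧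
          (fun t => ω (t + 1)) ∈ {ω | (next 0 true).output ω ∈ S}}
        {ω | ω 0 ∈ Qᶜ ∧ (fun t => ω (t + 1)) ∈ {ω | (next 0 false).output ω ∈ S}} :=
      Set.disjoint_left.2 fun ω h h' => h'.1 h.1
    have hp0 := askProb_nonneg D q
    have hp1 := askProb_le_one D q
    have hc : (D.prod (volume : Measure unitInterval)) Qᶜ = ENNReal.ofReal (1 - askProb D q) := by
      rw [← ofReal_measureReal, measureReal_compl h1]
      simp [askProb, hQ]
    rw [hset, measure_union hdisj hm',
      streamLaw_prod_preimage D h1 (measurableSet_output (h3 0 true) S),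
      streamLaw_prod_preimage D h1.compl hm, ih 0 true (h3 0 true), ih 0 false (h3 0 false), hc,
      ← ofReal_measureReal (s := Q), ← ENNReal.ofReal_mul measureReal_nonneg,
      ← ENNReal.ofReal_mul (by linarith), ← ENNReal.ofReal_add]
    · rfl
    · exact mul_nonneg measureReal_nonneg (prob_nonneg D _ S)
    · exact mul_nonneg (by linarith) (prob_nonneg D _ S)

end Prob

/-! ### Numbers of samples -/

/-- The second protocol runs on the unread rest of the stream. Which rest it is does not matter,
because the bounds below hold for every stream. -/
theorem samples_bind (p : Protocol α) (f : α → Protocol β) (ω : ℕ → ℝ × unitInterval) :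
    ∃ a ω', (p.bind f).samples ω = p.samples ω + (f a).samples ω' := by
  induction p generalizing ω with
  | ret a => exact ⟨a, ω, by simp [samples, run]⟩
  | ask q next ih =>
    obtain ⟨a, ω', h⟩ := ih (ω 0).2 ((q (ω 0).2).answer (ω 0).1) (fun t => ω (t + 1))
    refine ⟨a, ω', ?_⟩
    simp only [samples, run, bind] at h ⊢
    omega

/-- The protocol uses at most `n` samples. -/
def UsesAtMost (p : Protocol α) (n : ℕ) : Prop := ∀ ω, p.samples ω ≤ n

theorem usesAtMost_ret (a : α) (n : ℕ) : (ret a).UsesAtMost n := fun _ => Nat.zero_le _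

theorem UsesAtMost.mono {p : Protocol α} {m n : ℕ} (h : p.UsesAtMost m) (hmn : m ≤ n) :
    p.UsesAtMost n := fun ω => (h ω).trans hmn

theorem UsesAtMost.bind {p : Protocol α} {f : α → Protocol β} {m n : ℕ} (hp : p.UsesAtMost m)
    (hf : ∀ a, (f a).UsesAtMost n) : (p.bind f).UsesAtMost (m + n) := by
  intro ω
  obtain ⟨a, ω', h⟩ := samples_bind p f ω
  rw [h]
  exact add_le_add (hp ω) (hf a ω')

theorem usesAtMost_ask {q : unitInterval → ThresholdQuery} {next : unitInterval → Bool → Protocol α}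
    {n : ℕ} (h : ∀ u y, (next u y).UsesAtMost n) : (ask q next).UsesAtMost (n + 1) :=
  fun _ => Nat.succ_le_succ (h _ _ _)

theorem usesAtMost_askOnce (q : unitInterval → ThresholdQuery) : (askOnce q).UsesAtMost 1 :=
  usesAtMost_ask fun _ _ => usesAtMost_ret _ 0

theorem UsesAtMost.replicate {p : Protocol α} {m : ℕ} (hp : p.UsesAtMost m) (n : ℕ) :
    (p.replicate n).UsesAtMost (n * m) := by
  induction n with
  | zero => exact usesAtMost_ret _ _
  | succ n ih =>
    refine (hp.bind (n := n * m + 0) fun a => ih.bind fun l => usesAtMost_ret _ _).mono ?_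
    ring_nf; rfl

theorem usesAtMost_frequency (q : unitInterval → ThresholdQuery) (n : ℕ) :
    (frequency q n).UsesAtMost n :=
  (((usesAtMost_askOnce q).replicate n).bind fun _ => usesAtMost_ret _ 0).mono (by simp)

theorem usesAtMost_sumOver {f : ι → Protocol ℝ} {n : ι → ℕ} (hf : ∀ i, (f i).UsesAtMost (n i))
    (l : List ι) : (sumOver f l).UsesAtMost (l.map n).sum := by
  induction l with
  | nil => exact usesAtMost_ret _ _
  | cons i l ih =>
    refine ((hf i).bind fun x => ih.bind fun s => usesAtMost_ret _ 0).mono ?_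
    simp

end Protocol

namespace Protocol

variable {α β ι : Type}

/-! ### Means and variances -/

/-- Under the law of the output of `p`, the function `f` has mean `m` and variance at most `v`. -/
structure HasMeanVar (D : Measure ℝ) (p : Protocol α) (f : α → ℝ) (m v : ℝ) : Prop where
  expect_eq : p.expect D f = m
  expect_sq_le : (p.expect D fun a => (f a - m) ^ 2) ≤ v

section MeanVar

variable {D : Measure ℝ}

theorem HasMeanVar.mono {p : Protocol α} {f : α → ℝ} {m v w : ℝ} (h : p.HasMeanVar D f m v)
    (hvw : v ≤ w) : p.HasMeanVar D f m w :=
  ⟨h.1, h.2.trans hvw⟩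

theorem hasMeanVar_ret (a : α) (f : α → ℝ) : (ret a).HasMeanVar D f (f a) 0 :=
  ⟨rfl, by simp [expect]⟩

theorem HasMeanVar.affine {p : Protocol α} {f : α → ℝ} {m v : ℝ} (h : p.HasMeanVar D f m v)
    (s t : ℝ) : p.HasMeanVar D (fun a => s * f a + t) (s * m + t) (s ^ 2 * v) := by
  refine ⟨by rw [expect_add, expect_const_mul, expect_const, h.1], ?_⟩
  have : (fun a => (s * f a + t - (s * m + t)) ^ 2) = fun a => s ^ 2 * (f a - m) ^ 2 := by
    funext a; ring
  rw [this, expect_const_mul]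
  exact mul_le_mul_of_nonneg_left h.2 (sq_nonneg s)

/-- The law of total variance. -/
theorem HasMeanVar.bind [IsProbabilityMeasure D] {p : Protocol α} {r : α → Protocol β} {f : α → ℝ}
    {g : β → ℝ} {m v w : ℝ} (hp : p.HasMeanVar D f m v)
    (hr : ∀ a, (r a).HasMeanVar D g (f a) w) : (p.bind r).HasMeanVar D g m (v + w) := by
  constructor
  · rw [expect_bind]
    simp only [fun a => (hr a).1, hp.1]
  · rw [expect_bind]
    calc _ ≤ p.expect D fun a => (f a - m) ^ 2 + w := by
          refine expect_mono D p fun a => ?_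
          -- Expanding around the conditional mean `f a` leaves a cross term that is affine in `g
          -- b`, so its expectation is known.
          have : (fun b => (g b - m) ^ 2) = fun b =>
              (g b - f a) ^ 2 + (2 * (f a - m) * g b + (m ^ 2 - f a ^ 2)) := by
            funext b; ring
          rw [this, expect_add, expect_add, expect_const_mul, expect_const, (hr a).1]
          nlinarith [(hr a).2]
      _ ≤ v + w := by
          rw [expect_add, expect_const]
          linarith [hp.2]

/-- Chebyshev's inequality. -/
theorem HasMeanVar.prob_le [IsProbabilityMeasure D] {p : Protocol α} {f : α → ℝ} {m v e : ℝ}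
    (h : p.HasMeanVar D f m v) (he : 0 < e) : p.prob D {a | e < |f a - m|} ≤ v / e ^ 2 := by
  rw [le_div_iff₀ (by positivity), mul_comm]
  refine (mul_prob_le_expect D p (fun a => sq_nonneg (f a - m)) fun a ha => ?_).trans h.2
  rw [← sq_abs (f a - m)]
  exact pow_le_pow_left₀ he.le (le_of_lt ha) 2

theorem hasMeanVar_sumOver [IsProbabilityMeasure D] {f : ι → Protocol ℝ} {m v : ι → ℝ}
    (hf : ∀ i, (f i).HasMeanVar D id (m i) (v i)) (l : List ι) :
    (sumOver f l).HasMeanVar D id (l.map m).sum (l.map v).sum := by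
  induction l with
  | nil => exact hasMeanVar_ret _ _
  | cons i l ih =>
    rw [List.map_cons, List.sum_cons, List.map_cons, List.sum_cons]
    have h1 : ∀ x : ℝ, ((sumOver f l).bind fun s => ret (x + s)).HasMeanVar D id
        (1 * x + (l.map m).sum) (l.map v).sum := by
      intro x
      have h := (ih.affine 1 x).bind (g := id) (r := fun s => ret (x + s)) fun s => by
        simpa [add_comm] using hasMeanVar_ret (D := D) (x + s) id
      simpa [add_comm] using h
    have h2 := HasMeanVar.bind ((hf i).affine 1 (l.map m).sum) h1
    simpa [sumOver] using h2

end MeanVar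

/-! ### Independent repetitions: exponential moments of counts, and empirical frequencies. -/

section Replicate

variable (D : Measure ℝ)

theorem expect_replicate_succ (p : Protocol α) (n : ℕ) (g : List α → ℝ) :
    (p.replicate (n + 1)).expect D g =
      p.expect D fun a => (p.replicate n).expect D fun l => g (a :: l) := by
  simp only [replicate, expect_bind]
  rfl

-- The generating function of a binomial count; by independence each run contributes one factor.
open Classical in
theorem expect_pow_countP (p : Protocol α) (S : Set α) (s : ℝ) (n : ℕ) :
    ((p.replicate n).expect D fun l => s ^ l.countP (· ∈ S)) =
      (1 - p.prob D S + p.prob D S * s) ^ n := by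
  induction n with
  | zero => simp [replicate, expect]
  | succ n ih =>
    rw [expect_replicate_succ]
    have : ∀ a, ((p.replicate n).expect D fun l => s ^ (a :: l).countP (· ∈ S)) =
        (1 - p.prob D S + p.prob D S * s) ^ n * ((s - 1) * S.indicator 1 a + 1) := by
      intro a
      rw [← ih]
      by_cases ha : a ∈ S
      · simp only [List.countP_cons, ha, indicator_of_mem, Pi.one_apply, decide_true, if_true,
          pow_succ]
        simp only [mul_comm _ s, expect_const_mul]
        ring
      · simp [ha]
    simp only [this]
    rw [expect_const_mul, expect_add, expect_const_mul, expect_const, pow_succ]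
    congr 1
    simp only [prob]
    ring

open Classical in
/-- If a run is bad with probability at most `p₀`, then it is exponentially unlikely that half of
`n` independent runs are bad. -/
theorem prob_replicate_countP_le [IsProbabilityMeasure D] (p : Protocol α) (S : Set α)
    {s p₀ ρ : ℝ} (hs : 1 ≤ s) (hp : p.prob D S ≤ p₀) (hρ : 1 - p₀ + p₀ * s ^ 2 ≤ ρ * s) (n : ℕ) :
    (p.replicate n).prob D {l | n ≤ 2 * l.countP (· ∈ S)} ≤ ρ ^ n := by
  have hs0 : 0 < s ^ n := by positivity
  -- Exponential Markov inequality: on the event, the weight s^(2 · count) is at least s^n, while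
  -- each run contributes a factor of at most ρ s.
  have h1 := mul_prob_le_expect D (p.replicate n)
    (f := fun l => (s ^ 2) ^ l.countP (· ∈ S)) (fun l => by positivity)
    (S := {l | n ≤ 2 * l.countP (· ∈ S)}) (c := s ^ n) (fun l hl => by
      rw [← pow_mul]
      exact pow_le_pow_right₀ hs hl)
  rw [expect_pow_countP] at h1
  have h0 := prob_nonneg D p S
  have hs2 : 1 ≤ s ^ 2 := one_le_pow₀ hs
  have h2 : (1 - p.prob D S + p.prob D S * s ^ 2) ^ n ≤ (ρ * s) ^ n := by
    refine pow_le_pow_left₀ (by nlinarith [prob_le_one D p S]) (le_trans ?_ hρ) n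
    nlinarith
  rw [mul_pow] at h2
  have h3 := h1.trans h2
  rw [mul_comm] at h3
  exact le_of_mul_le_mul_right h3 hs0

theorem expect_askOnce (q : unitInterval → ThresholdQuery) (f : Bool → ℝ) :
    (askOnce q).expect D f = askProb D q * f true + (1 - askProb D q) * f false := rfl

theorem hasMeanVar_count [IsProbabilityMeasure D] (q : unitInterval → ThresholdQuery) (n : ℕ) :
    ((askOnce q).replicate n).HasMeanVar D (fun l => (l.count true : ℝ)) (n * askProb D q)
      (n * (askProb D q * (1 - askProb D q))) := by
  induction n with
  | zero =>
    rw [replicate]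
    simpa using hasMeanVar_ret (D := D) ([] : List Bool) fun l => (l.count true : ℝ)
  | succ n ih =>
    have h1 : ∀ a : Bool, (((askOnce q).replicate n).bind fun l => ret (a :: l)).HasMeanVar D
        (fun l => (l.count true : ℝ)) ((if a = true then 1 else 0) + n * askProb D q)
        (n * (askProb D q * (1 - askProb D q)) + 0) := fun a =>
      HasMeanVar.bind (f := fun l => (l.count true : ℝ) + if a = true then 1 else 0)
        (by simpa [add_comm] using ih.affine 1 (if a = true then 1 else 0))
        fun l => by
          simpa [List.count_cons] using
            hasMeanVar_ret (D := D) (a :: l) fun l => (l.count true : ℝ)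
    have h0 : (askOnce q).HasMeanVar D (fun a => (if a = true then 1 else 0) + n * askProb D q)
        ((n + 1) * askProb D q) (askProb D q * (1 - askProb D q)) :=
      ⟨by rw [expect_askOnce]; simp; ring, le_of_eq <| by rw [expect_askOnce]; simp; ring⟩
    have h2 := h0.bind h1
    push_cast
    exact h2.mono (le_of_eq (by ring))

theorem hasMeanVar_frequency [IsProbabilityMeasure D] (q : unitInterval → ThresholdQuery) {n : ℕ}
    (hn : 0 < n) : (frequency q n).HasMeanVar D id (askProb D q)
      (askProb D q * (1 - askProb D q) / n) := by
  have hn' : (n : ℝ) ≠ 0 := by positivity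
  have h := (hasMeanVar_count D q n).affine (n : ℝ)⁻¹ 0
  have h2 := h.bind (r := fun l => ret ((l.count true : ℝ) / n)) (g := id) (w := 0) fun l => by
    simpa [div_eq_inv_mul] using hasMeanVar_ret (D := D) ((l.count true : ℝ) / n) id
  have e1 : (n : ℝ)⁻¹ * (n * askProb D q) + 0 = askProb D q := by field_simp; ring
  rw [e1] at h2
  exact h2.mono (le_of_eq (by field_simp; ring))

end Replicate

end Protocol

/-! ### Medians of lists -/

-- In a sorted list, an entry below `a` forces all earlier entries below `a`, and an entry above `b`
-- forces all later ones above `b`. For a middle index, either side contains at least half of the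
-- list.
open Classical in
theorem getElem_mem_Icc_of_countP {l : List ℝ} (hl : l.Pairwise (· ≤ ·)) {a b : ℝ} {k : ℕ}
    (hk : k < l.length) (h1 : l.length ≤ 2 * (l.length - k)) (h2 : l.length ≤ 2 * (k + 1))
    (hc : 2 * l.countP (· ∈ (Icc a b)ᶜ) < l.length) : l[k] ∈ Icc a b := by
  by_contra hmem
  rw [mem_Icc, not_and_or, not_le, not_le] at hmem
  rw [List.pairwise_iff_getElem] at hl
  rcases hmem with h | h
  · have h3 : (l.take (k + 1)).countP (· ∈ (Icc a b)ᶜ) = (l.take (k + 1)).length := by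
      rw [List.countP_eq_length]
      intro x hx
      obtain ⟨i, hi, rfl⟩ := List.getElem_of_mem hx
      rw [List.length_take] at hi
      rw [List.getElem_take]
      have : l[i] ≤ l[k] := by
        rcases (show i ≤ k by omega).eq_or_lt with rfl | hik
        · exact le_rfl
        · exact hl i k _ hk hik
      simp only [mem_compl_iff, mem_Icc, decide_eq_true_eq]
      intro h'
      linarith [h'.1]
    have h4 := (List.take_sublist (k + 1) l).countP_le (p := fun x => decide (x ∈ (Icc a b)ᶜ))
    rw [h3, List.length_take] at h4
    omega
  · have h3 : (l.drop k).countP (· ∈ (Icc a b)ᶜ) = (l.drop k).length := by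
      rw [List.countP_eq_length]
      intro x hx
      obtain ⟨i, hi, rfl⟩ := List.getElem_of_mem hx
      rw [List.length_drop] at hi
      rw [List.getElem_drop]
      have : l[k] ≤ l[k + i] := by
        rcases (Nat.zero_le i).eq_or_lt with rfl | hik
        · exact le_rfl
        · exact hl k (k + i) hk _ (by omega)
      simp only [mem_compl_iff, mem_Icc, decide_eq_true_eq]
      intro h'
      linarith [h'.2]
    have h4 := (List.drop_sublist k l).countP_le (p := fun x => decide (x ∈ (Icc a b)ᶜ))
    rw [h3, List.length_drop] at h4
    omega

open Classical in
/-- If more than half of the entries of a list lie in an interval, then so does the median. -/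
theorem listMedian_mem_Icc {l : List ℝ} {a b : ℝ}
    (hc : 2 * l.countP (· ∈ (Icc a b)ᶜ) < l.length) : listMedian l ∈ Icc a b := by
  have hlen : (l.insertionSort (· ≤ ·)).length = l.length := List.length_insertionSort _ _
  have hsort : (l.insertionSort (· ≤ ·)).Pairwise (· ≤ ·) := List.pairwise_insertionSort _ _
  have hcount : (l.insertionSort (· ≤ ·)).countP (· ∈ (Icc a b)ᶜ) = l.countP (· ∈ (Icc a b)ᶜ) :=
    (List.perm_insertionSort (· ≤ ·) l).countP_eq _
  have h1 := getElem_mem_Icc_of_countP hsort (a := a) (b := b) (k := (l.length - 1) / 2)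
    (by omega) (by omega) (by omega) (by omega)
  have h2 := getElem_mem_Icc_of_countP hsort (a := a) (b := b) (k := l.length / 2)
    (by omega) (by omega) (by omega) (by omega)
  rw [listMedian, List.getD_eq_getElem _ _ (by omega), List.getD_eq_getElem _ _ (by omega)]
  constructor
  · linarith [h1.1, h2.1]
  · linarith [h1.2, h2.2]

namespace Protocol

/-- Boosting the success probability of an estimate by the median of independent runs. -/
theorem prob_listMedian_replicate_le (D : Measure ℝ) [IsProbabilityMeasure D] (p : Protocol ℝ)
    {m e : ℝ} (hp : p.prob D {x | e < |x - m|} ≤ 1 / 4) {n : ℕ} :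
    (p.replicate n).prob D {l | e < |listMedian l - m|} ≤ (7 / 8) ^ n := by
  classical
  -- With s = 2 and p₀ = 1/4, 1 - p₀ + p₀ s² = 7/4 = (7/8) s.
  refine le_trans ?_ (prob_replicate_countP_le D p {x | e < |x - m|} (s := 2) (by norm_num) hp
    (ρ := 7 / 8) (by norm_num) n)
  refine prob_mono_of_always D (replicate_always_length p n) fun l hl h => ?_
  by_contra hc
  rw [mem_ofPred_eq, not_le] at hc
  have hset : {x : ℝ | e < |x - m|} = (Icc (m - e) (m + e))ᶜ := by
    ext x
    rw [mem_ofPred_eq, mem_compl_iff, mem_Icc, ← not_le, abs_le]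
    constructor <;> rintro h ⟨h1, h2⟩ <;> exact h ⟨by linarith, by linarith⟩
  simp only [hset] at hc
  rw [← hl] at hc
  have := listMedian_mem_Icc hc
  rw [mem_ofPred_eq, ← not_le, abs_le] at h
  exact h ⟨by linarith [this.1], by linarith [this.2]⟩

end Protocol

/-! ### Moments of the distributions in the family -/

namespace InFamily

variable {k lam σ : ℝ} {D : Measure ℝ}

theorem mono_scale (h : InFamily k lam σ D) (hk : 1 < k) (hσ : 0 < σ) {σ' : ℝ} (hσ' : σ ≤ σ') :
    InFamily k lam σ' D :=
  ⟨h.1, h.2, h.3, h.4, h.5.trans (Real.rpow_le_rpow hσ.le hσ' (by linarith))⟩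

theorem integrable_abs_sub (h : InFamily k lam σ D) (c : ℝ) : Integrable (fun x => |x - c|) D :=
  have := h.1
  (h.2.sub (integrable_const c)).abs

theorem integrable_sub (h : InFamily k lam σ D) (c : ℝ) : Integrable (fun x => x - c) D :=
  have := h.1
  h.2.sub (integrable_const c)

theorem integral_sub (h : InFamily k lam σ D) (c : ℝ) : ∫ x, (x - c) ∂D = distMean D - c := by
  have := h.1
  rw [MeasureTheory.integral_sub h.2 (integrable_const c)]
  simp [distMean]

theorem integral_abs_sub_mean_le (h : InFamily k lam σ D) (hk : 1 < k) (hσ : 0 < σ) :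
    ∫ x, |x - distMean D| ∂D ≤ σ := by
  have := h.1
  -- Bernoulli's inequality: the tangent to t^k at t = 1, with t = |x - μ| / σ. Integrating it
  -- replaces Jensen's inequality.
  have hpt : ∀ x, σ ^ k * (1 - k + k / σ * |x - distMean D|) ≤ |x - distMean D| ^ k := by
    intro x
    have h1 := one_add_mul_self_le_rpow_one_add (s := |x - distMean D| / σ - 1) (p := k)
      (by have : 0 ≤ |x - distMean D| / σ := by positivity
          linarith) hk.le
    rw [add_sub_cancel, Real.div_rpow (abs_nonneg _) hσ.le, le_div_iff₀ (by positivity)] at h1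
    calc _ = (1 + k * (|x - distMean D| / σ - 1)) * σ ^ k := by ring
      _ ≤ _ := h1
  have hint := h.integrable_abs_sub (distMean D)
  have h2 := integral_mono (((integrable_const (1 - k)).add (hint.const_mul (k / σ))).const_mul
    (σ ^ k)) h.4 hpt
  simp only [Pi.add_apply] at h2
  rw [integral_const_mul, integral_add (integrable_const _) (hint.const_mul _),
    integral_const_mul, integral_const, probReal_univ, one_smul] at h2
  have h3 := h2.trans h.5
  have h4 : 0 < σ ^ k := by positivity
  have h5 : 1 - k + k / σ * ∫ x, |x - distMean D| ∂D ≤ 1 := by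
    by_contra hc
    push Not at hc
    nlinarith
  have h6 : k * (∫ x, |x - distMean D| ∂D) ≤ k * σ := by
    have : k / σ * (∫ x, |x - distMean D| ∂D) * σ ≤ k * σ := by gcongr; linarith
    calc _ = k / σ * (∫ x, |x - distMean D| ∂D) * σ := by field_simp
      _ ≤ _ := this
  exact le_of_mul_le_mul_left h6 (by linarith)

theorem integrable_max_sub (h : InFamily k lam σ D) (c : ℝ) :
    Integrable (fun x => max (x - c) 0) D :=
  have := h.1
  (h.integrable_sub c).sup (integrable_const 0)

/-- The centred variable has mean zero, so its positive part carries exactly half of the first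
absolute moment. -/
theorem integral_max_sub_mean_le (h : InFamily k lam σ D) (hk : 1 < k) (hσ : 0 < σ) :
    ∫ x, max (x - distMean D) 0 ∂D ≤ σ / 2 := by
  have := h.1
  have heq : ∀ x, max (x - distMean D) 0 = (|x - distMean D| + (x - distMean D)) * 2⁻¹ := by
    intro x
    rcases le_total 0 (x - distMean D) with hx | hx
    · rw [max_eq_left hx, abs_of_nonneg hx]; ring
    · rw [max_eq_right hx, abs_of_nonpos hx]; ring
  simp only [heq]
  rw [integral_mul_const, integral_add (h.integrable_abs_sub _) (h.integrable_sub _),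
    h.integral_sub]
  linarith [h.integral_abs_sub_mean_le hk hσ]

theorem integral_max_mean_sub_le (h : InFamily k lam σ D) (hk : 1 < k) (hσ : 0 < σ) :
    ∫ x, max (distMean D - x) 0 ∂D ≤ σ / 2 := by
  have := h.1
  have heq : ∀ x, max (distMean D - x) 0 = max (x - distMean D) 0 - (x - distMean D) := by
    intro x
    rcases le_total 0 (x - distMean D) with hx | hx
    · rw [max_eq_left hx, max_eq_right (by linarith)]; ring
    · rw [max_eq_right hx, max_eq_left (by linarith)]; ring
  simp only [heq]
  rw [MeasureTheory.integral_sub (h.integrable_max_sub _) (h.integrable_sub _), h.integral_sub]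
  linarith [h.integral_max_sub_mean_le hk hσ]

/-- Markov's inequality for the positive part gains a factor 2 over the one for |X - μ|. This factor
is what puts every median within σ of the mean. -/
theorem real_Ici_le (h : InFamily k lam σ D) (hk : 1 < k) (hσ : 0 < σ) {s γ : ℝ} (hs : 0 < s)
    (hγ : distMean D + s * σ ≤ γ) : D.real (Ici γ) ≤ 1 / (2 * s) := by
  have := h.1
  have h1 := mul_meas_ge_le_integral_of_nonneg (μ := D) (f := fun x => max (x - distMean D) 0)
    (Filter.Eventually.of_forall fun x => le_max_right _ _)
    ((h.2.sub (integrable_const _)).sup (integrable_const 0)) (s * σ)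
  have h2 : D.real (Ici γ) ≤ D.real {x | s * σ ≤ max (x - distMean D) 0} :=
    measureReal_mono fun x hx => by
      rw [mem_Ici] at hx
      rw [mem_ofPred_eq]
      exact le_max_of_le_left (by linarith)
  have h3 := h.integral_max_sub_mean_le hk hσ
  have h4 : s * σ * D.real (Ici γ) ≤ σ / 2 := by
    refine le_trans (mul_le_mul_of_nonneg_left h2 (by positivity)) (h1.trans h3)
  rw [le_div_iff₀ (by positivity)]
  have h5 : σ * (D.real (Ici γ) * (2 * s)) ≤ σ * 1 := by linarith
  exact le_of_mul_le_mul_left h5 hσ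

theorem real_Iic_le (h : InFamily k lam σ D) (hk : 1 < k) (hσ : 0 < σ) {s γ : ℝ} (hs : 0 < s)
    (hγ : γ ≤ distMean D - s * σ) : D.real (Iic γ) ≤ 1 / (2 * s) := by
  have := h.1
  have h1 := mul_meas_ge_le_integral_of_nonneg (μ := D) (f := fun x => max (distMean D - x) 0)
    (Filter.Eventually.of_forall fun x => le_max_right _ _)
    (((integrable_const _).sub h.2).sup (integrable_const 0)) (s * σ)
  have h2 : D.real (Iic γ) ≤ D.real {x | s * σ ≤ max (distMean D - x) 0} :=
    measureReal_mono fun x hx => by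
      rw [mem_Iic] at hx
      rw [mem_ofPred_eq]
      exact le_max_of_le_left (by linarith)
  have h3 := h.integral_max_mean_sub_le hk hσ
  have h4 : s * σ * D.real (Iic γ) ≤ σ / 2 := by
    refine le_trans (mul_le_mul_of_nonneg_left h2 (by positivity)) (h1.trans h3)
  rw [le_div_iff₀ (by positivity)]
  have h5 : σ * (D.real (Iic γ) * (2 * s)) ≤ σ * 1 := by linarith
  exact le_of_mul_le_mul_left h5 hσ

theorem abs_median_sub_mean_le (h : InFamily k lam σ D) (hk : 1 < k) (hσ : 0 < σ) {m : ℝ}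
    (hm : IsMedian D m) : |m - distMean D| ≤ σ := by
  have := h.1
  have key : ∀ {S : Set ℝ}, 1 / 2 ≤ D S → 1 / 2 ≤ D.real S := fun {S} hS => by
    have := (ENNReal.toReal_le_toReal (by simp) (measure_ne_top D S)).2 hS
    simpa [measureReal_def] using this
  have hle := key hm.1
  have hge := key hm.2
  rw [abs_le]
  constructor
  · by_contra hc
    push Not at hc
    set s := (distMean D - m) / σ with hs
    have hsσ : s * σ = distMean D - m := by rw [hs]; field_simp
    have h1 : 1 < s := by rw [hs, lt_div_iff₀ hσ]; linarith
    have h2 := h.real_Iic_le hk hσ (s := s) (γ := m) (by linarith) (by linarith)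
    have h3 : 1 / (2 * s) < 1 / 2 := by
      apply one_div_lt_one_div_of_lt <;> linarith
    linarith
  · by_contra hc
    push Not at hc
    set s := (m - distMean D) / σ with hs
    have hsσ : s * σ = m - distMean D := by rw [hs]; field_simp
    have h1 : 1 < s := by rw [hs, lt_div_iff₀ hσ]; linarith
    have h2 := h.real_Ici_le hk hσ (s := s) (γ := m) (by linarith) (by linarith)
    have h3 : 1 / (2 * s) < 1 / 2 := by
      apply one_div_lt_one_div_of_lt <;> linarith
    linarith

/-- Lower order moments about a point near the mean. -/
theorem integral_abs_sub_rpow_le (h : InFamily k lam σ D) (hσ : 0 < σ) {p c : ℝ} (hp : 1 < p)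
    (hp3 : p ≤ 3) (hpk : p ≤ k) (hc : |c - distMean D| ≤ 2 * σ) :
    Integrable (fun x => |x - c| ^ p) D ∧ ∫ x, |x - c| ^ p ∂D ≤ 80 * σ ^ p := by
  have := h.1
  set μ := distMean D
  -- The constant in the conclusion is 80 = 8 (9 + 1), since the normalized k-th moment is at most
  -- 1. Here |x - c| ≤ 2 max(|x - μ|, 2σ) moves the centre and t^p ≤ 1 + t^k lowers the exponent.
  have hpt : ∀ x, |x - c| ^ p ≤ 8 * (σ ^ p * (9 + (σ ^ k)⁻¹ * |x - μ| ^ k)) := by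
    intro x
    have h2p : (2 : ℝ) ^ p ≤ 8 := by
      calc (2 : ℝ) ^ p ≤ 2 ^ (3 : ℝ) := Real.rpow_le_rpow_of_exponent_le (by norm_num) hp3
        _ = 8 := by norm_num
    have h2 : (2 * σ) ^ p ≤ 8 * σ ^ p := by
      rw [Real.mul_rpow (by norm_num) hσ.le]
      gcongr
    have h3 : |x - μ| ^ p ≤ σ ^ p * (1 + (σ ^ k)⁻¹ * |x - μ| ^ k) := by
      have ht : 0 ≤ |x - μ| / σ := by positivity
      have h4 : (|x - μ| / σ) ^ p ≤ 1 + (|x - μ| / σ) ^ k := by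
        rcases le_total (|x - μ| / σ) 1 with h1 | h1
        · have := Real.rpow_le_one ht h1 (by linarith : 0 ≤ p)
          have := Real.rpow_nonneg ht k
          linarith
        · have := Real.rpow_le_rpow_of_exponent_le h1 hpk
          linarith
      rw [Real.div_rpow (abs_nonneg _) hσ.le, Real.div_rpow (abs_nonneg _) hσ.le,
        div_le_iff₀ (by positivity)] at h4
      calc _ ≤ _ := h4
        _ = _ := by ring
    have h4 : |x - c| ≤ 2 * max |x - μ| (2 * σ) := by
      have : |x - c| ≤ |x - μ| + |c - μ| := by
        have := abs_sub (x - μ) (c - μ)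
        rwa [show x - μ - (c - μ) = x - c by ring] at this
      linarith [le_max_left |x - μ| (2 * σ), le_max_right |x - μ| (2 * σ)]
    have hm0 : 0 ≤ max |x - μ| (2 * σ) := le_max_of_le_left (abs_nonneg _)
    calc |x - c| ^ p ≤ (2 * max |x - μ| (2 * σ)) ^ p :=
          Real.rpow_le_rpow (abs_nonneg _) h4 (by linarith)
      _ = 2 ^ p * max |x - μ| (2 * σ) ^ p := Real.mul_rpow (by norm_num) hm0
      _ ≤ 8 * (|x - μ| ^ p + (2 * σ) ^ p) := by
          refine mul_le_mul h2p ?_ (by positivity) (by norm_num)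
          rcases max_choice |x - μ| (2 * σ) with h5 | h5 <;> rw [h5]
          · linarith [Real.rpow_nonneg (by positivity : 0 ≤ 2 * σ) p]
          · linarith [Real.rpow_nonneg (abs_nonneg (x - μ)) p]
      _ ≤ 8 * (σ ^ p * (1 + (σ ^ k)⁻¹ * |x - μ| ^ k) + 8 * σ ^ p) := by gcongr
      _ = _ := by ring
  have hdom : Integrable (fun x => 8 * (σ ^ p * (9 + (σ ^ k)⁻¹ * |x - μ| ^ k))) D :=
    (((integrable_const 9).add (h.4.const_mul _)).const_mul _).const_mul _
  have hint : Integrable (fun x => |x - c| ^ p) D := by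
    refine hdom.mono' (Measurable.aestronglyMeasurable (by fun_prop)) (Filter.Eventually.of_forall fun x => ?_)
    rw [Real.norm_of_nonneg (by positivity)]
    exact hpt x
  refine ⟨hint, (integral_mono hint hdom hpt).trans ?_⟩
  rw [integral_const_mul, integral_const_mul,
    integral_add (integrable_const 9) (h.4.const_mul _), integral_const_mul, integral_const,
    probReal_univ, one_smul]
  have h5 : (σ ^ k)⁻¹ * ∫ x, |x - μ| ^ k ∂D ≤ 1 := by
    rw [inv_mul_le_one₀ (by positivity)]
    exact h.5
  have : 0 < σ ^ p := by positivity
  nlinarith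

end InFamily

/-! ### Probabilities of threshold queries -/

section Queries

variable (D : Measure ℝ)

theorem measurableSet_answer {q : unitInterval → ThresholdQuery} {g : unitInterval → ℝ}
    (hg : Measurable g) (hq : (∀ u, q u = .le (g u)) ∨ ∀ u, q u = .ge (g u)) :
    MeasurableSet {z : ℝ × unitInterval | (q z.2).answer z.1 = true} := by
  rcases hq with hq | hq <;> simp only [hq, ThresholdQuery.answer, decide_eq_true_eq]
  · exact measurableSet_le measurable_fst (hg.comp measurable_snd)
  · exact measurableSet_le (hg.comp measurable_snd) measurable_fst

theorem askProb_ge_const (γ : ℝ) : askProb D (fun _ => .ge γ) = D.real (Ici γ) := by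
  have : {z : ℝ × unitInterval | (ThresholdQuery.ge γ).answer z.1 = true} = Ici γ ×ˢ univ := by
    ext z; simp [ThresholdQuery.answer]
  rw [askProb, this, measureReal_prod_prod]
  simp

theorem askProb_le_const (γ : ℝ) : askProb D (fun _ => .le γ) = D.real (Iic γ) := by
  have : {z : ℝ × unitInterval | (ThresholdQuery.le γ).answer z.1 = true} = Iic γ ×ˢ univ := by
    ext z; simp [ThresholdQuery.answer]
  rw [askProb, this, measureReal_prod_prod]
  simp

theorem askProb_eq_integral {q : unitInterval → ThresholdQuery}
    (hq : MeasurableSet {z : ℝ × unitInterval | (q z.2).answer z.1 = true}) :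
    askProb D q = ∫ x, (volume : Measure unitInterval).real {u | (q u).answer x = true} ∂D := by
  rw [askProb, measureReal_def, Measure.prod_apply hq, ← integral_toReal]
  · rfl
  · exact (measurable_measure_prodMk_left hq).aemeasurable
  · exact Filter.Eventually.of_forall fun x => measure_lt_top _ _

theorem volume_real_setOf_le (s : ℝ) :
    (volume : Measure unitInterval).real {u | (u : ℝ) ≤ s} = max 0 (min 1 s) := by
  rcases lt_or_ge s 0 with h0 | h0
  · have : {u : unitInterval | (u : ℝ) ≤ s} = ∅ := by
      ext u
      simpa using h0.trans_le u.2.1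
    rw [this, min_eq_right (by linarith), max_eq_left h0.le]
    simp
  rcases le_or_gt s 1 with h1 | h1
  · have : {u : unitInterval | (u : ℝ) ≤ s} = Iic ⟨s, h0, h1⟩ := rfl
    rw [this, measureReal_def, unitInterval.volume_Iic, min_eq_right h1, max_eq_right h0]
    exact ENNReal.toReal_ofReal h0
  · have : {u : unitInterval | (u : ℝ) ≤ s} = univ := by
      ext u
      simpa using u.2.2.trans h1.le
    rw [this, min_eq_left h1.le, max_eq_right zero_le_one]
    simp

theorem volume_real_setOf_ge (s : ℝ) :
    (volume : Measure unitInterval).real {u | s ≤ (u : ℝ)} = 1 - max 0 (min 1 s) := by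
  rcases lt_or_ge s 0 with h0 | h0
  · have : {u : unitInterval | s ≤ (u : ℝ)} = univ := by
      ext u
      simpa using h0.le.trans u.2.1
    rw [this, min_eq_right (by linarith), max_eq_left h0.le]
    simp
  rcases le_or_gt s 1 with h1 | h1
  · have : {u : unitInterval | s ≤ (u : ℝ)} = Ici ⟨s, h0, h1⟩ := rfl
    rw [this, measureReal_def, unitInterval.volume_Ici, min_eq_right h1, max_eq_right h0]
    exact ENNReal.toReal_ofReal (by simpa using h1)
  · have : {u : unitInterval | s ≤ (u : ℝ)} = ∅ := by
      ext u
      simpa using u.2.2.trans_lt h1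
    rw [this, min_eq_left h1.le, max_eq_right zero_le_one]
    simp

/-- For a fixed sample, the chance that the uniform threshold lies below it is the relative position
of the sample in the region, clamped to [0, 1]; then apply Fubini. -/
theorem askProb_ge_uniform (c : ℝ) {a b : ℝ} (hab : a < b) :
    askProb D (fun u => .ge (c + (a + (b - a) * (u : ℝ)))) =
      ∫ x, max 0 (min 1 ((x - c - a) / (b - a))) ∂D := by
  rw [askProb_eq_integral D (measurableSet_answer (g := fun u => c + (a + (b - a) * (u : ℝ)))
    (by fun_prop) (Or.inr fun _ => rfl))]
  congr 1
  funext x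
  rw [← volume_real_setOf_le]
  congr 1
  ext u
  simp only [ThresholdQuery.answer, mem_ofPred_eq, decide_eq_true_eq,
    le_div_iff₀ (sub_pos.2 hab)]
  constructor <;> intro h <;> linarith

variable [IsProbabilityMeasure D]

theorem integrable_clamp (c a b : ℝ) :
    Integrable (fun x => max 0 (min 1 ((x - c - a) / (b - a)))) D := by
  refine (integrable_const (1 : ℝ)).mono' (by fun_prop) (Filter.Eventually.of_forall fun x => ?_)
  rw [Real.norm_of_nonneg (le_max_left _ _)]
  exact max_le zero_le_one (min_le_left _ _)

theorem askProb_le_uniform (c : ℝ) {a b : ℝ} (hab : a < b) :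
    askProb D (fun u => .le (c + (a + (b - a) * (u : ℝ)))) =
      1 - ∫ x, max 0 (min 1 ((x - c - a) / (b - a))) ∂D := by
  rw [askProb_eq_integral D (measurableSet_answer (g := fun u => c + (a + (b - a) * (u : ℝ)))
    (by fun_prop) (Or.inl fun _ => rfl))]
  have : ∀ x, (volume : Measure unitInterval).real
      {u | (ThresholdQuery.le (c + (a + (b - a) * (u : ℝ)))).answer x = true} =
      1 - max 0 (min 1 ((x - c - a) / (b - a))) := by
    intro x
    rw [← volume_real_setOf_ge]
    congr 1
    ext u
    simp only [ThresholdQuery.answer, mem_ofPred_eq, decide_eq_true_eq,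
      div_le_iff₀ (sub_pos.2 hab)]
    constructor <;> intro h <;> linarith
  simp only [this]
  rw [integral_sub (integrable_const _) (integrable_clamp D c a b)]
  simp

end Queries

/-! ### The local estimates -/

namespace Protocol

variable {D : Measure ℝ}

theorem HasMeanVar.congr_mean {α : Type} {p : Protocol α} {f : α → ℝ} {m m' v : ℝ}
    (h : p.HasMeanVar D f m v) (hm : m = m') : p.HasMeanVar D f m' v := hm ▸ h

theorem HasMeanVar.bind_affine [IsProbabilityMeasure D] {p : Protocol ℝ} {r : ℝ → Protocol ℝ}
    {m v s t w : ℝ} (hp : p.HasMeanVar D id m v)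
    (hr : ∀ x, (r x).HasMeanVar D id (s * x + t) w) :
    (p.bind r).HasMeanVar D id (s * m + t) (s ^ 2 * v + w) :=
  HasMeanVar.bind (hp.affine s t) hr

end Protocol

open Protocol

section LocalEstimate

variable {D : Measure ℝ} [IsProbabilityMeasure D]

/-- With `C` the probability of `X - c ≥ T`, the mean of the local estimate. -/
theorem localEstimate_mean (c : ℝ) {a b : ℝ} (hab : a < b) :
    a * (D.real (Ici (c + a)) - ∫ x, max 0 (min 1 ((x - c - a) / (b - a))) ∂D) +
      b * ((1 - D.real (Ici (c + b))) -
        (1 - ∫ x, max 0 (min 1 ((x - c - a) / (b - a))) ∂D)) =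
      ∫ x in Ico (c + a) (c + b), (x - c) ∂D := by
  have h1 : ∀ γ : ℝ, D.real (Ici γ) = ∫ x, (Ici γ).indicator 1 x ∂D := fun γ =>
    (integral_indicator_one measurableSet_Ici).symm
  have h2 : ∀ γ : ℝ, Integrable ((Ici γ).indicator (1 : ℝ → ℝ)) D := fun γ =>
    (integrable_const (1 : ℝ)).indicator measurableSet_Ici
  have h3 := integrable_clamp D c a b
  rw [h1, h1, ← integral_indicator measurableSet_Ico]
  calc _ = a * (∫ x, (Ici (c + a)).indicator 1 x ∂D) - b * (∫ x, (Ici (c + b)).indicator 1 x ∂D) +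
        (b - a) * ∫ x, max 0 (min 1 ((x - c - a) / (b - a))) ∂D := by ring
    _ = ∫ x, (a * (Ici (c + a)).indicator 1 x - b * (Ici (c + b)).indicator 1 x +
        (b - a) * max 0 (min 1 ((x - c - a) / (b - a)))) ∂D := by
      have h4 : Integrable (fun x => a * (Ici (c + a)).indicator 1 x -
        b * (Ici (c + b)).indicator 1 x) D := ((h2 _).const_mul _).sub ((h2 _).const_mul _)
      rw [integral_add h4 (h3.const_mul _),
        integral_sub ((h2 _).const_mul _) ((h2 _).const_mul _), integral_const_mul,
        integral_const_mul, integral_const_mul]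
    _ = _ := by
      congr 1
      funext x
      -- The integrands agree pointwise: to the left of the region both vanish, inside it the sum is
      -- a + (x - c - a), and to the right a - b + (b - a) cancels.
      have hba : 0 < b - a := sub_pos.2 hab
      rcases lt_or_ge x (c + a) with hxa | hxa
      · rw [indicator_of_notMem (by simpa using hxa),
          indicator_of_notMem (by simpa using hxa.trans (by linarith)),
          indicator_of_notMem (by simp [hxa]), min_eq_right, max_eq_left]
        · ring
        · exact div_nonpos_of_nonpos_of_nonneg (by linarith) hba.le
        · rw [div_le_one hba]; linarith
      rcases lt_or_ge x (c + b) with hxb | hxb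
      · rw [indicator_of_mem (by simpa using hxa), indicator_of_notMem (by simpa using hxb),
          indicator_of_mem (by simp [hxa, hxb]), min_eq_right, max_eq_right]
        · rw [Pi.one_apply]
          field_simp
          ring
        · exact div_nonneg (by linarith) hba.le
        · rw [div_le_one hba]; linarith
      · rw [indicator_of_mem (by simpa using hxa), indicator_of_mem (by simpa using hxb),
          indicator_of_notMem (by simp [hxb]), min_eq_left, max_eq_right]
        · simp only [Pi.one_apply]
          ring
        · exact zero_le_one
        · rw [one_le_div hba]; linarith

/-- As p (1 - p) ≤ min(p, 1 - p), it suffices that the probabilities involved, or else their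
complements, are at most P. The first case serves regions to the right of the centre, the second
those to the left. The four frequencies have coefficients a, -a, -b, -b. -/
theorem hasMeanVar_localEstimate (c : ℝ) {a b P : ℝ}
    (hab : a < b) {n : ℕ} (hn : 0 < n)
    (hP : (D.real (Ici (c + a)) ≤ P ∧
        (∫ x, max 0 (min 1 ((x - c - a) / (b - a))) ∂D) ≤ P ∧ D.real (Ici (c + b)) ≤ P) ∨
      (1 - D.real (Ici (c + a)) ≤ P ∧
        1 - (∫ x, max 0 (min 1 ((x - c - a) / (b - a))) ∂D) ≤ P ∧
        1 - D.real (Ici (c + b)) ≤ P)) :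
    (localEstimate c a b n).HasMeanVar D id (∫ x in Ico (c + a) (c + b), (x - c) ∂D)
      (2 * (a ^ 2 + b ^ 2) * (P / n)) := by
  have hvar : ∀ p : ℝ, 0 ≤ p → p ≤ 1 → (p ≤ P ∨ 1 - p ≤ P) → p * (1 - p) / n ≤ P / n := by
    intro p h0 h1 h2
    gcongr
    rcases h2 with h2 | h2 <;> nlinarith
  have hq : ∀ (q : unitInterval → ThresholdQuery) (p : ℝ), askProb D q = p → (p ≤ P ∨ 1 - p ≤ P) →
      (frequency q n).HasMeanVar D id p (P / n) := by
    rintro q p rfl h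
    exact (hasMeanVar_frequency D q hn).mono
      (hvar _ (askProb_nonneg D q) (askProb_le_one D q) h)
  have f1 := hq _ _ (askProb_ge_const D (c + a)) (hP.imp And.left And.left)
  have f2 := hq _ _ (askProb_ge_uniform D c hab) (hP.imp (fun h => h.2.1) fun h => h.2.1)
  have f3 := hq _ _ (askProb_ge_const D (c + b)) (hP.imp (fun h => h.2.2) fun h => h.2.2)
  have f4 := hq _ _ (askProb_le_uniform D c hab)
    (hP.symm.imp (fun h => h.2.1) fun h => by linarith [h.2.1])
  rw [← localEstimate_mean c hab]
  -- The frequencies are averaged out from the last to the first; the conditional mean stays affine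
  -- in the remaining ones.
  have g4 : ∀ x1 x2 x3 : ℝ, _ := fun x1 x2 x3 =>
    f4.bind_affine (s := -b) (t := a * (x1 - x2) + b * (1 - x3)) (w := 0)
      (r := fun x4 => .ret (a * (x1 - x2) + b * ((1 - x3) - x4))) fun x4 =>
        (hasMeanVar_ret _ _).congr_mean (by simp only [id]; ring)
  have g3 : ∀ x1 x2 : ℝ, _ := fun x1 x2 =>
    f3.bind_affine (s := -b)
      (t := a * (x1 - x2) + b -
        b * (1 - ∫ x, max 0 (min 1 ((x - c - a) / (b - a))) ∂D)) fun x3 =>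
        (g4 x1 x2 x3).congr_mean (by ring)
  have g2 : ∀ x1 : ℝ, _ := fun x1 =>
    f2.bind_affine (s := -a)
      (t := a * x1 - b * D.real (Ici (c + b)) + b -
        b * (1 - ∫ x, max 0 (min 1 ((x - c - a) / (b - a))) ∂D)) fun x2 =>
        (g3 x1 x2).congr_mean (by ring)
  have g1 := f1.bind_affine (s := a)
      (t := -a * (∫ x, max 0 (min 1 ((x - c - a) / (b - a))) ∂D) -
        b * D.real (Ici (c + b)) + b -
        b * (1 - ∫ x, max 0 (min 1 ((x - c - a) / (b - a))) ∂D)) fun x1 =>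
        (g2 x1).congr_mean (by ring)
  exact (g1.congr_mean (by ring)).mono (le_of_eq (by ring))

theorem hasMeanVar_localEstimate_nonneg (c : ℝ) {a b : ℝ}
    (hab : a < b) {n : ℕ} (hn : 0 < n) :
    (localEstimate c a b n).HasMeanVar D id (∫ x in Ico (c + a) (c + b), (x - c) ∂D)
      (2 * (a ^ 2 + b ^ 2) * (D.real {x | a ≤ |x - c|} / n)) := by
  have hsub : D.real (Ici (c + a)) ≤ D.real {x | a ≤ |x - c|} := measureReal_mono fun x hx => by
    rw [mem_Ici] at hx
    rw [mem_ofPred_eq]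
    exact le_trans (by linarith) (le_abs_self _)
  refine hasMeanVar_localEstimate c hab hn (Or.inl ⟨hsub, ?_, ?_⟩)
  · refine le_trans ?_ hsub
    rw [← integral_indicator_one measurableSet_Ici]
    refine integral_mono (integrable_clamp D c a b)
      ((integrable_const (1 : ℝ)).indicator measurableSet_Ici) fun x => ?_
    by_cases hx : c + a ≤ x
    · simp [hx]
    · simp only [mem_Ici, hx, not_false_eq_true, indicator_of_notMem]
      refine max_le le_rfl (min_le_of_right_le ?_)
      exact div_nonpos_of_nonpos_of_nonneg (by linarith) (by linarith)
  · exact (measureReal_mono (Ici_subset_Ici.2 (by linarith))).trans hsub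

theorem hasMeanVar_localEstimate_nonpos (c : ℝ) {a b : ℝ}
    (hab : a < b) {n : ℕ} (hn : 0 < n) :
    (localEstimate c (-b) (-a) n).HasMeanVar D id (∫ x in Ico (c + -b) (c + -a), (x - c) ∂D)
      (2 * (a ^ 2 + b ^ 2) * (D.real {x | a ≤ |x - c|} / n)) := by
  have hsub : D.real (Iic (c + -a)) ≤ D.real {x | a ≤ |x - c|} := measureReal_mono fun x hx => by
    rw [mem_Iic] at hx
    rw [mem_ofPred_eq]
    exact le_trans (by linarith) (neg_le_abs _)
  have hcompl : ∀ γ, 1 - D.real (Ici γ) = D.real (Iio γ) := fun γ => by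
    rw [← compl_Ici, measureReal_compl measurableSet_Ici, probReal_univ]
  refine (hasMeanVar_localEstimate c (neg_lt_neg hab) hn (P := D.real {x | a ≤ |x - c|})
    (Or.inr ⟨?_, ?_, ?_⟩)).mono (le_of_eq (by ring))
  · rw [hcompl]
    exact (measureReal_mono fun x hx => by
      rw [mem_Iio] at hx; rw [mem_Iic]; linarith).trans hsub
  · refine le_trans ?_ hsub
    have hi : Integrable ((Iic (c + -a)).indicator (1 : ℝ → ℝ)) D :=
      (integrable_const (1 : ℝ)).indicator measurableSet_Iic
    rw [sub_le_iff_le_add, ← integral_indicator_one measurableSet_Iic, ← integral_add hi (integrable_clamp D c (-b) (-a))]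
    have h1 : ∫ _, (1 : ℝ) ∂D = 1 := by simp
    conv_lhs => rw [← h1]
    refine integral_mono (integrable_const _)
      (hi.add (integrable_clamp D c (-b) (-a))) fun x => ?_
    by_cases hx : x ≤ c + -a
    · simp [hx]
    · simp only [mem_Iic, hx, not_false_eq_true, indicator_of_notMem, zero_add]
      refine le_max_of_le_right (le_min le_rfl ?_)
      rw [one_le_div (by linarith)]
      linarith
  · rw [hcompl]
    exact (measureReal_mono Iio_subset_Iic_self).trans hsub

end LocalEstimate

/-! ### The base estimate -/

theorem sum_map_range (f : ℕ → ℝ) (n : ℕ) :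
    ((List.range n).map f).sum = ∑ j ∈ Finset.range n, f j := by
  induction n with
  | zero => simp
  | succ n ih => simp [List.range_succ, Finset.sum_range_succ, ih]

theorem gridPoint_nonneg (j : ℕ) : 0 ≤ gridPoint j := by
  unfold gridPoint
  split_ifs <;> positivity

theorem gridPoint_succ (j : ℕ) : gridPoint (j + 1) = 2 ^ (j + 1) := by
  simp [gridPoint]

theorem gridPoint_lt_succ (j : ℕ) : gridPoint j < gridPoint (j + 1) := by
  rw [gridPoint_succ, gridPoint]
  split_ifs with h
  · positivity
  · exact pow_lt_pow_right₀ (by norm_num) (by omega)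

theorem sum_setIntegral_regions {D : Measure ℝ} [IsProbabilityMeasure D]
    (hD : Integrable (fun x : ℝ => x) D) (c : ℝ) {g : ℕ → ℝ} (h0 : g 0 = 0) (hg : Monotone g)
    (n : ℕ) :
    ∑ j ∈ Finset.range n, ((∫ x in Ico (c + g j) (c + g (j + 1)), (x - c) ∂D) +
      ∫ x in Ico (c + -g (j + 1)) (c + -g j), (x - c) ∂D) =
      ∫ x in Ico (c + -g n) (c + g n), (x - c) ∂D := by
  have hadd : ∀ u v w : ℝ, u ≤ v → v ≤ w → ∫ x in Ico u w, (x - c) ∂D =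
      (∫ x in Ico u v, (x - c) ∂D) + ∫ x in Ico v w, (x - c) ∂D := by
    intro u v w huv hvw
    have hi : Integrable (fun x => x - c) D := hD.sub (integrable_const c)
    rw [← Ico_union_Ico_eq_Ico huv hvw]
    exact setIntegral_union (by
      rw [Set.disjoint_left]
      intro x hx hx'
      exact absurd hx.2 (not_lt.2 hx'.1)) measurableSet_Ico hi.integrableOn hi.integrableOn
  induction n with
  | zero => simp [h0]
  | succ n ih =>
    have h1 : g n ≤ g (n + 1) := hg (Nat.le_succ n)
    have h2 : 0 ≤ g n := h0 ▸ hg (Nat.zero_le n)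
    rw [Finset.sum_range_succ, ih, hadd (c + -g (n + 1)) (c + -g n) (c + g (n + 1))
      (by linarith) (by linarith),
      hadd (c + -g n) (c + g n) (c + g (n + 1)) (by linarith) (by linarith)]
    ring

/-- The truncation bias: outside the window |x - c| ≥ m, so |x - c| ≤ |x - c|^p / m^(p-1). -/
theorem abs_sub_setIntegral_le {D : Measure ℝ} [IsProbabilityMeasure D] {p c m M : ℝ} (hp : 1 < p)
    (hm : 0 < m) (hD : Integrable (fun x : ℝ => x) D)
    (hint : Integrable (fun x => |x - c| ^ p) D) (hM : ∫ x, |x - c| ^ p ∂D ≤ M) :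
    |(∫ x in Ico (c + -m) (c + m), (x - c) ∂D) - ∫ x, (x - c) ∂D| ≤ M / m ^ (p - 1) := by
  have hi : Integrable (fun x => x - c) D := hD.sub (integrable_const c)
  rw [← integral_indicator measurableSet_Ico, ← integral_sub (hi.indicator measurableSet_Ico) hi]
  refine (abs_integral_le_integral_abs).trans ?_
  calc _ ≤ ∫ x, |x - c| ^ p / m ^ (p - 1) ∂D := by
        refine integral_mono ((hi.indicator measurableSet_Ico).sub hi).abs
          (hint.div_const _) fun x => ?_
        by_cases hx : x ∈ Ico (c + -m) (c + m)
        · simp only [hx, indicator_of_mem, sub_self, abs_zero]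
          positivity
        · simp only [hx, not_false_eq_true, indicator_of_notMem, zero_sub, abs_neg]
          have h1 : m ≤ |x - c| := by
            by_contra hc
            rw [not_le, abs_lt] at hc
            exact hx ⟨by linarith [hc.1], by linarith [hc.2]⟩
          rw [le_div_iff₀ (by positivity)]
          calc |x - c| * m ^ (p - 1) ≤ |x - c| ^ (1 : ℝ) * |x - c| ^ (p - 1) := by
                rw [Real.rpow_one]
                gcongr
            _ = |x - c| ^ p := by
                rw [← Real.rpow_add (hm.trans_le h1)]
                congr 1; ring
    _ = (∫ x, |x - c| ^ p ∂D) / m ^ (p - 1) := integral_div _ _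
    _ ≤ _ := by gcongr

/-- The nonzero terms form a geometric progression of ratio at least 2, so the sum is at most twice
the last of them. That term is at most 2^p y^p, except when only j = 0 survives; the summand 1 on
the right covers this case. Taken at y = |x - c| / σ and integrated, this bounds the total variance
by a moment. -/
theorem sum_pow_indicator_gridPoint_le {p : ℝ} (hp : 1 < p) {y : ℝ} (hy : 0 ≤ y) (n : ℕ) :
    ∑ j ∈ Finset.range n, ((2 : ℝ) ^ p) ^ (j + 1) * (if gridPoint j ≤ y then 1 else 0) ≤
      2 * 2 ^ p * (1 + y ^ p) := by
  set q : ℝ := 2 ^ p with hq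
  have hq2 : 2 ≤ q := by
    calc (2 : ℝ) = 2 ^ (1 : ℝ) := by norm_num
      _ ≤ q := Real.rpow_le_rpow_of_exponent_le (by norm_num) hp.le
  have hyp : 0 ≤ y ^ p := Real.rpow_nonneg hy p
  induction n with
  | zero => simp only [Finset.range_zero, Finset.sum_empty]; positivity
  | succ n ih =>
    by_cases hn : gridPoint n ≤ y
    · have hgeom : ∀ N : ℕ, ∑ j ∈ Finset.range (N + 1),
          q ^ (j + 1) * (if gridPoint j ≤ y then 1 else 0) ≤ 2 * q ^ (N + 1) := by
        intro N
        induction N with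
        | zero =>
          rw [Finset.sum_range_one, zero_add, pow_one]
          split_ifs <;> linarith
        | succ N ihN =>
          rw [Finset.sum_range_succ]
          have h1 : q ^ (N + 1 + 1) = q * q ^ (N + 1) := by ring
          have h2 : 0 < q ^ (N + 1) := by positivity
          split_ifs <;> nlinarith
      refine (hgeom n).trans ?_
      rcases Nat.eq_zero_or_pos n with rfl | hn0
      · rw [zero_add, pow_one]
        nlinarith
      · have h1 : q ^ n ≤ y ^ p := by
          rw [gridPoint, if_neg hn0.ne'] at hn
          calc q ^ n = ((2 : ℝ) ^ n) ^ p := by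
                rw [hq, ← Real.rpow_natCast, ← Real.rpow_natCast, ← Real.rpow_mul (by norm_num),
                  ← Real.rpow_mul (by norm_num), mul_comm]
            _ ≤ y ^ p := Real.rpow_le_rpow (by positivity) hn (by linarith)
        rw [pow_succ]
        nlinarith
    · rw [Finset.sum_range_succ, if_neg hn, mul_zero, add_zero]
      exact ih

theorem allocation_pos {B k σ ε : ℝ} (hB : 0 < B) (hσ : 0 < σ) (hε : 0 < ε) (i : ℕ) :
    0 < allocation B k σ ε i :=
  Nat.ceil_pos.2 (by positivity)

theorem hasMeanVar_baseEstimate {D : Measure ℝ} [IsProbabilityMeasure D] {A B p σ ε c : ℝ}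
    (hD : Integrable (fun x : ℝ => x) D) (hp : 1 < p) (hσ : 0 < σ) (hε : 0 < ε) (hB : 0 < B)
    (hint : Integrable (fun x => |x - c| ^ p) D) :
    (baseEstimate A B p σ ε c).HasMeanVar D id
      (∫ x in Ico (c + -(gridPoint (numRegions A p σ ε) * σ))
        (c + gridPoint (numRegions A p σ ε) * σ), (x - c) ∂D)
      (8 * (ε ^ 2 / B) * (2 * 2 ^ p * (1 + (∫ x, |x - c| ^ p ∂D) / σ ^ p))) := by
  set I := numRegions A p σ ε
  have hlt : ∀ j, gridPoint j * σ < gridPoint (j + 1) * σ := fun j =>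
    mul_lt_mul_of_pos_right (gridPoint_lt_succ j) hσ
  have hloc : ∀ j : ℕ, ((localEstimate c (gridPoint j * σ) (gridPoint (j + 1) * σ)
      (allocation B p σ ε (j + 1))).bind fun x =>
      (localEstimate c (-(gridPoint (j + 1) * σ)) (-(gridPoint j * σ))
        (allocation B p σ ε (j + 1))).bind fun y => .ret (x + y)).HasMeanVar D id
      ((∫ x in Ico (c + gridPoint j * σ) (c + gridPoint (j + 1) * σ), (x - c) ∂D) +
        ∫ x in Ico (c + -(gridPoint (j + 1) * σ)) (c + -(gridPoint j * σ)), (x - c) ∂D)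
      (8 * (ε ^ 2 / B) * ((2 ^ p) ^ (j + 1) * D.real {x | gridPoint j * σ ≤ |x - c|})) := by
    intro j
    have hn := allocation_pos (k := p) hB hσ hε (j + 1)
    have h1 := hasMeanVar_localEstimate_nonneg (D := D) c (hlt j) hn
    have h2 := hasMeanVar_localEstimate_nonpos (D := D) c (hlt j) hn
    have h3 := h1.bind_affine (s := 1)
      (t := ∫ x in Ico (c + -(gridPoint (j + 1) * σ)) (c + -(gridPoint j * σ)), (x - c) ∂D) fun x =>
      (h2.bind_affine (r := fun y => .ret (x + y)) (s := 1) (t := x) (w := 0) fun y =>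
        (hasMeanVar_ret _ _).congr_mean (by simp only [id]; ring)).congr_mean (by ring)
    refine (h3.congr_mean (by ring)).mono ?_
    set P := D.real {x | gridPoint j * σ ≤ |x - c|}
    have hP : 0 ≤ P := measureReal_nonneg
    have hnB : B * ((σ / ε) ^ 2 * (2 : ℝ) ^ (((j + 1 : ℕ) : ℝ) * (2 - p))) ≤
        (allocation B p σ ε (j + 1) : ℝ) := Nat.le_ceil _
    have hab : (gridPoint j * σ) ^ 2 ≤ (gridPoint (j + 1) * σ) ^ 2 :=
      pow_le_pow_left₀ (mul_nonneg (gridPoint_nonneg j) hσ.le) (hlt j).le 2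
    -- The allocation is tuned for this identity: dividing the squared end point by the number of
    -- queries leaves (ε² / B) 2^((j+1)p).
    have hpow : ((2 : ℝ) ^ (j + 1)) ^ 2 =
        (2 ^ p) ^ (j + 1) * (2 : ℝ) ^ (((j + 1 : ℕ) : ℝ) * (2 - p)) := by
      rw [← Real.rpow_natCast, ← Real.rpow_natCast, ← Real.rpow_natCast,
        ← Real.rpow_mul (by norm_num), ← Real.rpow_mul (by norm_num),
        ← Real.rpow_add (by norm_num)]
      congr 1
      push_cast
      ring
    calc _ = 4 * ((gridPoint j * σ) ^ 2 + (gridPoint (j + 1) * σ) ^ 2) *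
          (P / allocation B p σ ε (j + 1)) := by ring
      _ ≤ 4 * ((gridPoint (j + 1) * σ) ^ 2 + (gridPoint (j + 1) * σ) ^ 2) *
          (P / (B * ((σ / ε) ^ 2 * (2 : ℝ) ^ (((j + 1 : ℕ) : ℝ) * (2 - p))))) := by gcongr
      _ = _ := by
        rw [gridPoint_succ, mul_pow, hpow]
        field_simp
        ring
  have hsum := hasMeanVar_sumOver hloc (List.range I)
  rw [sum_map_range, sum_map_range, sum_setIntegral_regions hD c (g := fun j => gridPoint j * σ)
    (by simp [gridPoint]) (monotone_nat_of_le_succ fun j => (hlt j).le)] at hsum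
  refine hsum.mono ?_
  rw [← Finset.mul_sum]
  refine mul_le_mul_of_nonneg_left ?_ (by positivity)
  have hms : ∀ j : ℕ, MeasurableSet {x : ℝ | gridPoint j * σ ≤ |x - c|} := fun j =>
    measurableSet_le measurable_const (by fun_prop)
  have hii : ∀ j : ℕ, Integrable ({x : ℝ | gridPoint j * σ ≤ |x - c|}.indicator (1 : ℝ → ℝ)) D :=
    fun j => (integrable_const (1 : ℝ)).indicator (hms j)
  calc _ = ∫ x, ∑ j ∈ Finset.range I,
        (2 ^ p) ^ (j + 1) * {x : ℝ | gridPoint j * σ ≤ |x - c|}.indicator (1 : ℝ → ℝ) x ∂D := by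
        rw [integral_finsetSum _ fun j _ => (hii j).const_mul _]
        refine Finset.sum_congr rfl fun j _ => ?_
        rw [integral_const_mul, integral_indicator_one (hms j)]
    _ ≤ ∫ x, 2 * 2 ^ p * (1 + |x - c| ^ p / σ ^ p) ∂D := by
        refine integral_mono (integrable_finsetSum _ fun j _ => (hii j).const_mul _)
          (((integrable_const 1).add (hint.div_const _)).const_mul _) fun x => ?_
        have := sum_pow_indicator_gridPoint_le hp (y := |x - c| / σ) (by positivity) I
        rw [Real.div_rpow (abs_nonneg _) hσ.le] at this
        refine le_trans (le_of_eq ?_) this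
        refine Finset.sum_congr rfl fun j _ => ?_
        simp only [indicator_apply, mem_ofPred_eq, le_div_iff₀ hσ, Pi.one_apply]
    _ = _ := by
        rw [integral_const_mul, integral_add (integrable_const 1) (hint.div_const _), integral_div]
        simp

theorem cutoff_le_gridPoint {A p σ ε : ℝ} (hA : 1 < A) (hp : 1 < p) (hε : 0 < ε) (hεσ : ε ≤ σ) :
    cutoff A p σ ε ≤ gridPoint (numRegions A p σ ε) * σ := by
  have hσ : 0 < σ := hε.trans_le hεσ
  have h1 : 1 < cutoff A p σ ε / σ := by
    have : 1 ≤ (σ / ε) ^ (1 / (p - 1)) :=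
      Real.one_le_rpow ((one_le_div hε).2 hεσ) (one_div_nonneg.2 (by linarith))
    rw [cutoff, show A * (σ * (σ / ε) ^ (1 / (p - 1))) / σ = A * (σ / ε) ^ (1 / (p - 1)) by
      field_simp]
    nlinarith
  -- Positivity matters because the grid starts at 0 and not at 2^0 = 1.
  have h2 : 0 < numRegions A p σ ε := Nat.ceil_pos.2 (Real.logb_pos (by norm_num) h1)
  rw [gridPoint, if_neg h2.ne', ← div_le_iff₀ hσ, ← Real.rpow_natCast]
  calc cutoff A p σ ε / σ = 2 ^ Real.logb 2 (cutoff A p σ ε / σ) :=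
        (Real.rpow_logb (by norm_num) (by norm_num) (by linarith)).symm
    _ ≤ _ := Real.rpow_le_rpow_of_exponent_le (by norm_num) (Nat.le_ceil _)

/-- The constant in the cutoff. -/
noncomputable def cutoffConst (p : ℝ) : ℝ := 160 ^ (1 / (p - 1))

theorem one_lt_cutoffConst {p : ℝ} (hp : 1 < p) : 1 < cutoffConst p :=
  Real.one_lt_rpow (by norm_num) (one_div_pos.2 (by linarith))

/-- The base estimate is accurate with constant probability. -/
theorem prob_baseEstimate_le {k lam σ ε p c : ℝ} {D : Measure ℝ} (h : InFamily k lam σ D)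
    (hp : 1 < p) (hp3 : p ≤ 3) (hpk : p ≤ k) (hε : 0 < ε) (hεσ : ε ≤ σ)
    (hc : |c - distMean D| ≤ 2 * σ) :
    (baseEstimate (cutoffConst p) 200000 p σ ε c).prob D {x | ε < |x - (distMean D - c)|} ≤
      1 / 4 := by
  have := h.1
  have hσ : 0 < σ := hε.trans_le hεσ
  obtain ⟨hint, hmom⟩ := h.integral_abs_sub_rpow_le hσ hp hp3 hpk hc
  have hmv := hasMeanVar_baseEstimate (A := cutoffConst p) (B := 200000) h.2 hp hσ hε
    (by norm_num) hint
  set m := gridPoint (numRegions (cutoffConst p) p σ ε) * σ with hm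
  have hcut := cutoff_le_gridPoint (one_lt_cutoffConst hp) hp hε hεσ
  rw [← hm] at hcut
  have hcutpos : 0 < cutoff (cutoffConst p) p σ ε := by
    have := one_lt_cutoffConst hp
    unfold cutoff
    positivity
  -- 160 is twice the moment constant 80, so that the bias uses up only half of ε; the other half is
  -- left for the deviation.
  have hpow : 160 * (σ ^ p / ε) ≤ m ^ (p - 1) := by
    refine le_trans (le_of_eq ?_) (Real.rpow_le_rpow hcutpos.le hcut (by linarith))
    have hp1 : p - 1 ≠ 0 := by linarith
    rw [cutoff, cutoffConst, Real.mul_rpow (by positivity) (by positivity),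
      Real.mul_rpow (by positivity) (by positivity), ← Real.rpow_mul (by norm_num),
      ← Real.rpow_mul (by positivity), one_div_mul_cancel hp1, Real.rpow_one, Real.rpow_one,
      Real.rpow_sub hσ, Real.rpow_one]
    field_simp
  have hbias := abs_sub_setIntegral_le hp (hcutpos.trans_le hcut) h.2 hint hmom
  rw [h.integral_sub] at hbias
  have hσp : 0 < σ ^ p := by positivity
  have hbias2 : 80 * σ ^ p / m ^ (p - 1) ≤ ε / 2 := by
    calc _ ≤ 80 * σ ^ p / (160 * (σ ^ p / ε)) := by gcongr
      _ = ε / 2 := by field_simp; norm_num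
  set M := ∫ x in Ico (c + -m) (c + m), (x - c) ∂D
  have hsub : {x : ℝ | ε < |x - (distMean D - c)|} ⊆ {x | ε / 2 < |id x - M|} := by
    intro x hx
    rw [mem_ofPred_eq] at hx ⊢
    have := abs_add_le (x - M) (M - (distMean D - c))
    rw [show x - M + (M - (distMean D - c)) = x - (distMean D - c) by ring] at this
    simp only [id]
    linarith
  refine (prob_mono D _ hsub).trans ((hmv.prob_le (half_pos hε)).trans ?_)
  have h2p : (2 : ℝ) ^ p ≤ 8 := by
    calc (2 : ℝ) ^ p ≤ 2 ^ (3 : ℝ) := Real.rpow_le_rpow_of_exponent_le (by norm_num) hp3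
      _ = 8 := by norm_num
  have hmom2 : (∫ x, |x - c| ^ p ∂D) / σ ^ p ≤ 80 := by
    rwa [div_le_iff₀ hσp]
  have hmom0 : 0 ≤ (∫ x, |x - c| ^ p ∂D) / σ ^ p :=
    div_nonneg (integral_nonneg fun x => by positivity) hσp.le
  -- The choice of `B`: 8 · 16 · 81 · 4 = 41472 is less than 200000 / 4.
  calc _ ≤ 8 * (ε ^ 2 / 200000) * (2 * 8 * (1 + 80)) / (ε / 2) ^ 2 := by gcongr
    _ ≤ 1 / 4 := by
      field_simp
      norm_num

/-! ### Localization: a noisy binary search with backtracking -/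

/-- One step of the search. The state `(x, ℓ)` stands for the interval `[x - ℓ, x + ℓ]`. If a query
says that the target is outside, then the interval is enlarged. Otherwise the step passes to one of
the halves (slightly enlarged), or stays where it is if the interval is already short. -/
noncomputable def locStep (ℓ₀ : ℝ) (s : ℝ × ℝ) : Protocol (ℝ × ℝ) :=
  .ask (fun _ => .ge (s.1 - s.2)) fun _ y₁ => if y₁ = false then .ret (s.1, 4 / 3 * s.2) else
  .ask (fun _ => .le (s.1 + s.2)) fun _ y₂ => if y₂ = false then .ret (s.1, 4 / 3 * s.2) else
  if s.2 ≤ ℓ₀ then .ret s else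
  .ask (fun _ => .le s.1) fun _ y₃ =>
    if y₃ = true then .ret (s.1 - s.2 / 2, 3 / 4 * s.2) else .ret (s.1 + s.2 / 2, 3 / 4 * s.2)

/-- The midpoints of the intervals that are visited in `n` steps of the search. -/
noncomputable def locWalk (ℓ₀ : ℝ) : ℕ → ℝ × ℝ → Protocol (List ℝ)
  | 0, _ => .ret []
  | n + 1, s => (locStep ℓ₀ s).bind fun s' => (locWalk ℓ₀ n s').bind fun l => .ret (s.1 :: l)

/-- The Lyapunov function of the search. -/
noncomputable def locPotential (μ : ℝ) (s : ℝ × ℝ) : ℝ := max s.2 (2 * (s.1 - μ) ^ 2 / s.2)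

theorem oblivious_locStep (ℓ₀ : ℝ) (s : ℝ × ℝ) : (locStep ℓ₀ s).Oblivious := by
  refine ⟨measurableSet_answer measurable_const (Or.inr fun _ => rfl), fun _ _ => rfl,
    fun _ y₁ => ?_⟩
  cases y₁ with
  | false => trivial
  | true =>
    simp only [Bool.true_eq_false, if_false]
    refine ⟨measurableSet_answer measurable_const (Or.inl fun _ => rfl), fun _ _ => rfl,
      fun _ y₂ => ?_⟩
    cases y₂
    · trivial
    simp only [Bool.true_eq_false, if_false]
    split_ifs
    · trivial
    refine ⟨measurableSet_answer measurable_const (Or.inl fun _ => rfl), fun _ _ => rfl,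
      fun _ y₃ => ?_⟩
    cases y₃ <;> trivial

theorem usesAtMost_locStep (ℓ₀ : ℝ) (s : ℝ × ℝ) : (locStep ℓ₀ s).UsesAtMost 3 := by
  refine usesAtMost_ask fun _ y₁ => ?_
  cases y₁ with
  | false => exact usesAtMost_ret _ _
  | true =>
    simp only [Bool.true_eq_false, if_false]
    refine usesAtMost_ask fun _ y₂ => ?_
    cases y₂
    · exact usesAtMost_ret _ _
    simp only [Bool.true_eq_false, if_false]
    split_ifs
    · exact usesAtMost_ret _ _
    refine usesAtMost_ask fun _ y₃ => ?_
    split_ifs <;> exact usesAtMost_ret _ _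

/-- Halving is attempted only above ℓ₀ and multiplies the half-length by 3/4, so it never falls
further than this. -/
theorem locStep_always {ℓ₀ : ℝ} (h₀ : 0 < ℓ₀) {s : ℝ × ℝ} (hs : 3 / 4 * ℓ₀ ≤ s.2) :
    (locStep ℓ₀ s).Always fun s' => 3 / 4 * ℓ₀ ≤ s'.2 := by
  intro _ y₁
  cases y₁ with
  | false => simp only [if_true, Always]; linarith
  | true =>
    simp only [Bool.true_eq_false, if_false]
    intro _ y₂
    cases y₂
    · simp only [if_true, Always]; linarith
    simp only [Bool.true_eq_false, if_false]
    split_ifs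
    · exact hs
    intro _ y₃
    cases y₃ <;> simp only [Bool.false_eq_true, if_true, if_false, Always] <;> linarith

theorem expect_locStep (D : Measure ℝ) (ℓ₀ : ℝ) (s : ℝ × ℝ) (f : ℝ × ℝ → ℝ) :
    (locStep ℓ₀ s).expect D f =
      (1 - D.real (Ici (s.1 - s.2)) * D.real (Iic (s.1 + s.2))) * f (s.1, 4 / 3 * s.2) +
      D.real (Ici (s.1 - s.2)) * D.real (Iic (s.1 + s.2)) *
        (if s.2 ≤ ℓ₀ then f s else
          D.real (Iic s.1) * f (s.1 - s.2 / 2, 3 / 4 * s.2) +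
            (1 - D.real (Iic s.1)) * f (s.1 + s.2 / 2, 3 / 4 * s.2)) := by
  by_cases h : s.2 ≤ ℓ₀
  · simp [locStep, expect, askProb_ge_const, askProb_le_const, h]
    ring
  · simp [locStep, expect, askProb_ge_const, askProb_le_const, h]
    ring

theorem oblivious_locWalk (ℓ₀ : ℝ) (n : ℕ) (s : ℝ × ℝ) : (locWalk ℓ₀ n s).Oblivious := by
  induction n generalizing s with
  | zero => trivial
  | succ n ih => exact (oblivious_locStep ℓ₀ s).bind fun s' => (ih s').bind fun _ => trivial

theorem usesAtMost_locWalk (ℓ₀ : ℝ) (n : ℕ) (s : ℝ × ℝ) : (locWalk ℓ₀ n s).UsesAtMost (3 * n) := by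
  induction n generalizing s with
  | zero => exact usesAtMost_ret _ _
  | succ n ih =>
    exact ((usesAtMost_locStep ℓ₀ s).bind fun s' =>
      (ih s').bind fun _ => usesAtMost_ret _ 0).mono (by omega)

theorem locWalk_always_length (ℓ₀ : ℝ) (n : ℕ) (s : ℝ × ℝ) :
    (locWalk ℓ₀ n s).Always fun l => l.length = n := by
  induction n generalizing s with
  | zero => rfl
  | succ n ih =>
    refine (always_of_forall (Q := fun _ => True) (fun _ => trivial) (locStep ℓ₀ s)).bind
      fun s' _ => (ih s').bind fun l hl => ?_
    simp [Always, hl]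

/-! ### Effect of the single moves of the search on the potential. -/

section Potential

theorem locPotential_pos {μ : ℝ} {s : ℝ × ℝ} (hs : 0 < s.2) : 0 < locPotential μ s :=
  lt_max_of_lt_left hs

theorem locPotential_enlarge_le (μ x : ℝ) {ℓ : ℝ} (hℓ : 0 < ℓ) :
    locPotential μ (x, 4 / 3 * ℓ) ≤ 4 / 3 * locPotential μ (x, ℓ) := by
  have h1 := le_max_left ℓ (2 * (x - μ) ^ 2 / ℓ)
  have h2 := le_max_right ℓ (2 * (x - μ) ^ 2 / ℓ)
  have h3 : 2 * (x - μ) ^ 2 / (4 / 3 * ℓ) = 3 / 4 * (2 * (x - μ) ^ 2 / ℓ) := by field_simp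
  have h4 : 0 ≤ 2 * (x - μ) ^ 2 / ℓ := by positivity
  simp only [locPotential]
  rw [h3]
  exact max_le (by linarith) (by linarith)

/-- When the target is outside, or barely inside, the quadratic term of the potential exceeds (16/9)
ℓ, and enlarging divides it by 4/3; the new length is 4/3 ℓ = (3/4)(16/9) ℓ. The factor 2 in the
potential is what makes this work at the boundary. -/
theorem locPotential_enlarge_le_of_far {μ x ℓ w : ℝ} (hw : 0 < w) (hℓ : 64 * w ≤ ℓ)
    (h : ℓ - w ≤ |x - μ|) :
    locPotential μ (x, 4 / 3 * ℓ) ≤ 3 / 4 * locPotential μ (x, ℓ) := by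
  have hℓ0 : 0 < ℓ := by linarith
  have h2 := le_max_right ℓ (2 * (x - μ) ^ 2 / ℓ)
  have h3 : 2 * (x - μ) ^ 2 / (4 / 3 * ℓ) = 3 / 4 * (2 * (x - μ) ^ 2 / ℓ) := by field_simp
  have h5 : (63 / 64 * ℓ) ^ 2 ≤ (x - μ) ^ 2 := by
    rw [← sq_abs (x - μ)]
    exact pow_le_pow_left₀ (by linarith) (by linarith) 2
  have h4 : 16 / 9 * ℓ ≤ 2 * (x - μ) ^ 2 / ℓ := by
    rw [le_div_iff₀ hℓ0]
    nlinarith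
  simp only [locPotential]
  rw [h3]
  exact max_le (by linarith) (by linarith)

/-- The worst case, for a step into the wrong half. -/
theorem locPotential_child_le (μ x : ℝ) {ℓ t : ℝ} (hℓ : 0 < ℓ) (ht : t ^ 2 = (ℓ / 2) ^ 2) :
    locPotential μ (x + t, 3 / 4 * ℓ) ≤ 4 * locPotential μ (x, ℓ) := by
  have h1 := le_max_left ℓ (2 * (x - μ) ^ 2 / ℓ)
  have h2 := le_max_right ℓ (2 * (x - μ) ^ 2 / ℓ)
  have h3 : 2 * (x + t - μ) ^ 2 / (3 / 4 * ℓ) ≤ 8 / 3 * (2 * (x - μ) ^ 2 / ℓ) + 4 / 3 * ℓ := by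
    rw [div_le_iff₀ (by positivity)]
    have : (8 / 3 * (2 * (x - μ) ^ 2 / ℓ) + 4 / 3 * ℓ) * (3 / 4 * ℓ) =
      4 * (x - μ) ^ 2 + ℓ ^ 2 := by field_simp; ring
    rw [this]
    nlinarith [sq_nonneg (x - μ - t)]
  simp only [locPotential]
  refine max_le (by linarith) (h3.trans (by linarith))

/-- For a step into a correct half: 2 (33/64)² / (3/4) < 3/4. -/
theorem locPotential_child_le_of_near (μ x : ℝ) {x' ℓ w : ℝ} (hw : 0 < w)
    (hℓ : 64 * w ≤ ℓ) (h : |x' - μ| ≤ ℓ / 2 + w) :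
    locPotential μ (x', 3 / 4 * ℓ) ≤ 3 / 4 * locPotential μ (x, ℓ) := by
  have hℓ0 : 0 < ℓ := by linarith
  have h1 := le_max_left ℓ (2 * (x - μ) ^ 2 / ℓ)
  have h5 : (x' - μ) ^ 2 ≤ (33 / 64 * ℓ) ^ 2 := by
    rw [← sq_abs (x' - μ)]
    exact pow_le_pow_left₀ (abs_nonneg _) (by linarith) 2
  simp only [locPotential]
  refine max_le (by linarith) ?_
  rw [div_le_iff₀ (by positivity)]
  nlinarith

end Potential

/-! ### Expected contraction of the potential, and the median of the visited midpoints. -/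

section Walk

variable {D : Measure ℝ} [IsProbabilityMeasure D] {μ w : ℝ}

/-- The two outcomes of a step, weighted. -/
theorem mix_le {t F M V f m C : ℝ} (h0 : 0 ≤ t) (h1 : t ≤ 1) (hV : 0 ≤ V) (hF : F ≤ f * V)
    (hM : M ≤ m * V) (hC : (1 - t) * f + t * m ≤ C) : (1 - t) * F + t * M ≤ C * V :=
  calc _ ≤ (1 - t) * (f * V) + t * (m * V) :=
        add_le_add (mul_le_mul_of_nonneg_left hF (by linarith)) (mul_le_mul_of_nonneg_left hM h0)
    _ = ((1 - t) * f + t * m) * V := by ring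
    _ ≤ _ := mul_le_mul_of_nonneg_right hC hV

/-- Away from the end points by more than w, the containment test errs with probability at most
2/128; within w of an end point both of its outcomes are harmless. Only the short intervals near the
target can fail to contract: there a false alarm, of probability at most 2/128, enlarges by 4/3, a
growth of at most 1 + 1/192. -/
theorem expect_locPotential_locStep_le
    (hge : ∀ γ, μ + w ≤ γ → D.real (Ici γ) ≤ 1 / 128)
    (hle : ∀ γ, γ ≤ μ - w → D.real (Iic γ) ≤ 1 / 128) (hw : 0 < w) (ℓ₀ : ℝ) {s : ℝ × ℝ} (hs : 64 * w ≤ s.2) :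
    (locStep ℓ₀ s).expect D (locPotential μ) ≤ 129 / 128 * locPotential μ s ∧
    (¬ (s.2 ≤ ℓ₀ ∧ |s.1 - μ| ≤ s.2 + w) →
      (locStep ℓ₀ s).expect D (locPotential μ) ≤ 7 / 8 * locPotential μ s) := by
  obtain ⟨x, ℓ⟩ := s
  simp only at hs ⊢
  have hℓ : 0 < ℓ := by linarith
  rw [expect_locStep]
  simp only
  have hV := (locPotential_pos (μ := μ) (s := (x, ℓ)) hℓ).le
  have hF := locPotential_enlarge_le μ x hℓ
  have hVl : locPotential μ (x - ℓ / 2, 3 / 4 * ℓ) ≤ 4 * locPotential μ (x, ℓ) :=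
    locPotential_child_le μ x hℓ (t := -(ℓ / 2)) (by ring)
  have hVr := locPotential_child_le μ x hℓ (t := ℓ / 2) rfl
  have hge1 : ∀ γ, γ ≤ μ - w → 1 - D.real (Ici γ) ≤ 1 / 128 := fun γ hγ => by
    rw [← probReal_compl_eq_one_sub measurableSet_Ici, compl_Ici]
    exact (measureReal_mono Iio_subset_Iic_self).trans (hle γ hγ)
  have hle1 : ∀ γ, μ + w ≤ γ → 1 - D.real (Iic γ) ≤ 1 / 128 := fun γ hγ => by
    rw [← probReal_compl_eq_one_sub measurableSet_Iic, compl_Iic]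
    exact (measureReal_mono Ioi_subset_Ici_self).trans (hge γ hγ)
  have a0 : 0 ≤ D.real (Ici (x - ℓ)) := measureReal_nonneg
  have a1 : D.real (Ici (x - ℓ)) ≤ 1 := measureReal_le_one
  have b0 : 0 ≤ D.real (Iic (x + ℓ)) := measureReal_nonneg
  have b1 : D.real (Iic (x + ℓ)) ≤ 1 := measureReal_le_one
  have c0 : 0 ≤ D.real (Iic x) := measureReal_nonneg
  have c1 : D.real (Iic x) ≤ 1 := measureReal_le_one
  have t0 : 0 ≤ D.real (Ici (x - ℓ)) * D.real (Iic (x + ℓ)) := mul_nonneg a0 b0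
  have t1 : D.real (Ici (x - ℓ)) * D.real (Iic (x + ℓ)) ≤ 1 := mul_le_one₀ a1 b0 b1
  have tin : |x - μ| < ℓ - w →
      1 - 2 / 128 ≤ D.real (Ici (x - ℓ)) * D.real (Iic (x + ℓ)) := by
    intro h
    rw [abs_lt] at h
    have h1 := hge1 (x - ℓ) (by linarith)
    have h2 := hle1 (x + ℓ) (by linarith)
    nlinarith
  have tout : ℓ + w < |x - μ| →
      D.real (Ici (x - ℓ)) * D.real (Iic (x + ℓ)) ≤ 1 / 128 := by
    intro h
    rw [lt_abs] at h
    rcases h with h | h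
    · have := hge (x - ℓ) (by linarith)
      nlinarith
    · have := hle (x + ℓ) (by linarith)
      nlinarith
  set V := locPotential μ (x, ℓ)
  set t := D.real (Ici (x - ℓ)) * D.real (Iic (x + ℓ))
  set pM := D.real (Iic x)
  have hfar := locPotential_enlarge_le_of_far (μ := μ) (x := x) hw hs
  have houtside : ℓ + w < |x - μ| → ∀ M, M ≤ 4 * V →
      (1 - t) * locPotential μ (x, 4 / 3 * ℓ) + t * M ≤ 7 / 8 * V := fun h M hM =>
    mix_le t0 t1 hV (hfar (by linarith)) hM (by linarith [tout h])
  by_cases hleaf : ℓ ≤ ℓ₀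
  · rw [if_pos hleaf]
    by_cases hout : ℓ + w < |x - μ|
    · have := houtside hout V (by linarith)
      exact ⟨by linarith, fun _ => this⟩
    · refine ⟨?_, fun h => absurd ⟨hleaf, not_lt.1 hout⟩ h⟩
      rcases lt_or_ge |x - μ| (ℓ - w) with hin | hin
      · exact mix_le t0 t1 hV hF (le_of_eq (one_mul V).symm) (by linarith [tin hin])
      · exact mix_le t0 t1 hV (hfar hin) (le_of_eq (one_mul V).symm) (by linarith)
  · rw [if_neg hleaf]
    suffices h : (1 - t) * locPotential μ (x, 4 / 3 * ℓ) +
        t * (pM * locPotential μ (x - ℓ / 2, 3 / 4 * ℓ) +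
          (1 - pM) * locPotential μ (x + ℓ / 2, 3 / 4 * ℓ)) ≤ 7 / 8 * V from
      ⟨by linarith, fun _ => h⟩
    have hmix : ∀ {f m C : ℝ}, locPotential μ (x - ℓ / 2, 3 / 4 * ℓ) ≤ f * V →
        locPotential μ (x + ℓ / 2, 3 / 4 * ℓ) ≤ m * V → pM * f + (1 - pM) * m ≤ C →
        pM * locPotential μ (x - ℓ / 2, 3 / 4 * ℓ) +
          (1 - pM) * locPotential μ (x + ℓ / 2, 3 / 4 * ℓ) ≤ C * V := fun hf hm hC => by
      have := mix_le (t := 1 - pM) (by linarith) (by linarith) hV hf hm (by simpa using hC)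
      simpa using this
    by_cases hout : ℓ + w < |x - μ|
    · exact houtside hout _ (hmix hVl hVr (by linarith))
    rw [not_lt, abs_le] at hout
    have hl : μ ≤ x + w → locPotential μ (x - ℓ / 2, 3 / 4 * ℓ) ≤ 3 / 4 * V := fun h =>
      locPotential_child_le_of_near μ x hw hs (abs_le.2 ⟨by linarith, by linarith⟩)
    have hr : x - w ≤ μ → locPotential μ (x + ℓ / 2, 3 / 4 * ℓ) ≤ 3 / 4 * V := fun h =>
      locPotential_child_le_of_near μ x hw hs (abs_le.2 ⟨by linarith, by linarith⟩)
    -- A wrong turn has probability at most 1/128 and costs the factor 4 instead of 3/4, an excess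
    -- of 13/512. If the target is within w of the midpoint, both halves are correct.
    have hmid : pM * locPotential μ (x - ℓ / 2, 3 / 4 * ℓ) +
        (1 - pM) * locPotential μ (x + ℓ / 2, 3 / 4 * ℓ) ≤ (3 / 4 + 13 / 512) * V := by
      rcases le_or_gt μ (x - w) with h1 | h1
      · exact hmix (hl (by linarith)) hVr (by linarith [hle1 x (by linarith)])
      rcases le_or_gt (x + w) μ with h2 | h2
      · exact hmix hVl (hr (by linarith)) (by linarith [hle x (by linarith)])
      · exact hmix (hl h2.le) (hr h1.le) (by linarith)
    rcases lt_or_ge |x - μ| (ℓ - w) with hin | hin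
    · exact mix_le t0 t1 hV hF hmid (by linarith [tin hin])
    · exact mix_le t0 t1 hV (hfar hin) hmid (by linarith)

-- A supermartingale argument: a bad midpoint is charged (16/15)², which the contraction 7/8 at such
-- a state pays for, and every step costs at most 129/128. The potential never falls below (3/4) ℓ₀,
-- which starts the induction.
open Classical in
theorem expect_locWalk_le
    (hge : ∀ γ, μ + w ≤ γ → D.real (Ici γ) ≤ 1 / 128)
    (hle : ∀ γ, γ ≤ μ - w → D.real (Iic γ) ≤ 1 / 128) (hw : 0 < w) {ℓ₀ : ℝ} (h₀ : 128 * w ≤ ℓ₀) (n : ℕ) {s : ℝ × ℝ}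
    (hs : 3 / 4 * ℓ₀ ≤ s.2) :
    ((locWalk ℓ₀ n s).expect D fun l =>
      ((16 / 15 : ℝ) ^ 2) ^ l.countP (· ∈ {y | ℓ₀ + w < |y - μ|})) ≤
      (129 / 128) ^ n * (locPotential μ s / (3 / 4 * ℓ₀)) := by
  have hℓ₀ : 0 < ℓ₀ := by linarith
  induction n generalizing s with
  | zero =>
    simp only [locWalk, expect, List.countP_nil, pow_zero, one_mul]
    rw [one_le_div (by positivity)]
    exact hs.trans (le_max_left _ _)
  | succ n ih =>
    obtain ⟨hstep1, hstep2⟩ := expect_locPotential_locStep_le hge hle hw ℓ₀ (s := s) (by linarith)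
    have hV := locPotential_pos (μ := μ) (s := s) (by linarith)
    set u : ℝ := if s.1 ∈ {y | ℓ₀ + w < |y - μ|} then (16 / 15) ^ 2 else 1 with hu
    have hu0 : 0 ≤ u := by rw [hu]; split_ifs <;> norm_num
    have hcons : ∀ l : List ℝ, ((16 / 15 : ℝ) ^ 2) ^
        (s.1 :: l).countP (· ∈ {y | ℓ₀ + w < |y - μ|}) =
        u * ((16 / 15 : ℝ) ^ 2) ^ l.countP (· ∈ {y | ℓ₀ + w < |y - μ|}) := by
      intro l
      rw [List.countP_cons, pow_add, mul_comm, hu]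
      by_cases h : s.1 ∈ {y | ℓ₀ + w < |y - μ|} <;> simp [h]
    have hbound : ((locWalk ℓ₀ (n + 1) s).expect D fun l =>
        ((16 / 15 : ℝ) ^ 2) ^ l.countP (· ∈ {y | ℓ₀ + w < |y - μ|})) ≤
        u * ((129 / 128) ^ n / (3 / 4 * ℓ₀) * (locStep ℓ₀ s).expect D (locPotential μ)) := by
      simp only [locWalk, expect_bind, expect, hcons]
      simp only [expect_const_mul]
      refine mul_le_mul_of_nonneg_left ?_ hu0
      rw [← expect_const_mul]
      refine expect_mono_of_always D (locStep_always hℓ₀ hs) fun s' hs' => (ih hs').trans ?_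
      exact le_of_eq (by ring)
    refine hbound.trans ?_
    -- At a bad midpoint (16/15)² · 7/8 = 224/225 < 1; at a good one no charge is made.
    have hfac : u * (locStep ℓ₀ s).expect D (locPotential μ) ≤ 129 / 128 * locPotential μ s := by
      rw [hu]
      split_ifs with h
      · have := hstep2 fun hc => by
          rw [mem_ofPred_eq] at h
          linarith [hc.1, hc.2]
        nlinarith
      · linarith
    calc _ = (129 / 128) ^ n / (3 / 4 * ℓ₀) *
          (u * (locStep ℓ₀ s).expect D (locPotential μ)) := by ring
      _ ≤ (129 / 128) ^ n / (3 / 4 * ℓ₀) * (129 / 128 * locPotential μ s) := by gcongr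
      _ = _ := by ring

/-- A bad median needs at least half of the midpoints to be bad, which makes the weight at least
(16/15)^n. Markov's inequality gives the rate (129/128)(15/16) < 19/20. -/
theorem prob_listMedian_locWalk_le
    (hge : ∀ γ, μ + w ≤ γ → D.real (Ici γ) ≤ 1 / 128)
    (hle : ∀ γ, γ ≤ μ - w → D.real (Iic γ) ≤ 1 / 128) (hw : 0 < w) {ℓ₀ : ℝ} (h₀ : 128 * w ≤ ℓ₀) (n : ℕ) {s : ℝ × ℝ}
    (hs : 3 / 4 * ℓ₀ ≤ s.2) :
    (locWalk ℓ₀ n s).prob D {l | ℓ₀ + w < |listMedian l - μ|} ≤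
      (19 / 20) ^ n * (locPotential μ s / (3 / 4 * ℓ₀)) := by
  classical
  have hℓ₀ : 0 < ℓ₀ := by linarith
  have hsub : (locWalk ℓ₀ n s).prob D {l | ℓ₀ + w < |listMedian l - μ|} ≤
      (locWalk ℓ₀ n s).prob D {l | n ≤ 2 * l.countP (· ∈ {y | ℓ₀ + w < |y - μ|})} := by
    refine prob_mono_of_always D (locWalk_always_length ℓ₀ n s) fun l hl h => ?_
    by_contra hc
    rw [mem_ofPred_eq, not_le] at hc
    have hset : {y : ℝ | ℓ₀ + w < |y - μ|} = (Icc (μ - (ℓ₀ + w)) (μ + (ℓ₀ + w)))ᶜ := by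
      ext x
      rw [mem_ofPred_eq, mem_compl_iff, mem_Icc, ← not_le, abs_le]
      constructor <;> rintro h ⟨h1, h2⟩ <;> exact h ⟨by linarith, by linarith⟩
    simp only [hset] at hc
    rw [← hl] at hc
    have := listMedian_mem_Icc hc
    rw [mem_ofPred_eq, ← not_le, abs_le] at h
    exact h ⟨by linarith [this.1], by linarith [this.2]⟩
  refine hsub.trans ?_
  have h1 := mul_prob_le_expect D (locWalk ℓ₀ n s)
    (f := fun l => ((16 / 15 : ℝ) ^ 2) ^ l.countP (· ∈ {y | ℓ₀ + w < |y - μ|}))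
    (fun l => by positivity) (S := {l | n ≤ 2 * l.countP (· ∈ {y | ℓ₀ + w < |y - μ|})})
    (c := (16 / 15) ^ n) (fun l hl => by
      rw [← pow_mul]
      exact pow_le_pow_right₀ (by norm_num) hl)
  have h2 := h1.trans (expect_locWalk_le hge hle hw h₀ n hs)
  have hV := locPotential_pos (μ := μ) (s := s) (by linarith)
  rw [mul_comm, ← le_div_iff₀ (by positivity)] at h2
  refine h2.trans ?_
  rw [div_le_iff₀ (by positivity)]
  calc _ ≤ (19 / 20 * (16 / 15)) ^ n * (locPotential μ s / (3 / 4 * ℓ₀)) := by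
        gcongr
        norm_num
    _ = _ := by rw [mul_pow]; ring

end Walk

/-! ### Localization: refinement by majority votes on a grid -/

namespace Protocol

/-- Union bound for sums. -/
theorem prob_sumOver_le {ι : Type} (D : Measure ℝ) [IsProbabilityMeasure D] {f : ι → Protocol ℝ}
    {lo hi : ι → ℝ} {e : ℝ} (he : 0 ≤ e) (hf : ∀ i, (f i).prob D (Icc (lo i) (hi i))ᶜ ≤ e)
    (l : List ι) :
    (sumOver f l).prob D (Icc (l.map lo).sum (l.map hi).sum)ᶜ ≤ l.length * e := by
  induction l with
  | nil => simp [sumOver, prob, expect]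
  | cons i l ih =>
    have h0 : 0 ≤ l.length * e := by positivity
    refine (prob_bind_le D (f i) _ (Icc (lo i) (hi i))ᶜ _ h0 fun x hx => ?_).trans ?_
    · rw [prob_bind_ret]
      refine (prob_mono D _ ?_).trans ih
      intro s hs
      rw [mem_compl_iff, not_not, mem_Icc] at hx
      rw [mem_preimage, mem_compl_iff, mem_Icc, List.map_cons, List.map_cons, List.sum_cons,
        List.sum_cons] at hs
      rw [mem_compl_iff, mem_Icc]
      rintro ⟨h1, h2⟩
      exact hs ⟨by linarith [hx.1], by linarith [hx.2]⟩
    · rw [List.length_cons]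
      push_cast
      linarith [hf i]

end Protocol

/-- Majority vote of `n` agents on the query `1{x ≥ γ}`. -/
noncomputable def majorityVote (n : ℕ) (γ : ℝ) : Protocol ℝ :=
  ((askOnce fun _ => .ge γ).replicate n).bind fun l => .ret (if n < 2 * l.count true then 1 else 0)

theorem oblivious_askOnce_const (q : ThresholdQuery) : (askOnce fun _ => q).Oblivious := by
  refine ⟨?_, fun _ _ => rfl, fun _ _ => trivial⟩
  cases q with
  | le γ => exact measurableSet_answer measurable_const (Or.inl fun _ => rfl)
  | ge γ => exact measurableSet_answer measurable_const (Or.inr fun _ => rfl)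

theorem oblivious_majorityVote (n : ℕ) (γ : ℝ) : (majorityVote n γ).Oblivious :=
  ((oblivious_askOnce_const _).replicate n).bind fun _ => trivial

theorem usesAtMost_majorityVote (n : ℕ) (γ : ℝ) : (majorityVote n γ).UsesAtMost n :=
  (((usesAtMost_askOnce _).replicate n).bind fun _ => usesAtMost_ret _ 0).mono (by simp)

/-- The vote is reliable only for γ outside [a, b); inside, both values are allowed and the event is
empty. The base 17/18 comes from s = 3/2 and p₀ = 1/3. -/
theorem prob_majorityVote_le {D : Measure ℝ} [IsProbabilityMeasure D] {a b γ : ℝ} (hab : a ≤ b)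
    (hle : γ < a → D.real (Iic γ) ≤ 1 / 3) (hge : b ≤ γ → D.real (Ici γ) ≤ 1 / 3) (n : ℕ) :
    (majorityVote n γ).prob D (Icc (if γ < a then 1 else 0) (if γ < b then 1 else 0))ᶜ ≤
      (17 / 18) ^ n := by
  rw [majorityVote, prob_bind_ret]
  have htail : ∀ y : Bool, (askOnce fun _ => .ge γ).prob D {y} ≤ 1 / 3 →
      ((askOnce fun _ => ThresholdQuery.ge γ).replicate n).prob D {l | n ≤ 2 * l.count y} ≤
        (17 / 18) ^ n := fun y hy => by
    have := prob_replicate_countP_le D _ {y} (s := 3 / 2) (by norm_num) hy (ρ := 17 / 18)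
      (by norm_num) n
    refine (prob_mono D _ fun l hl => ?_).trans this
    exact hl.trans (Nat.mul_le_mul_left 2 (List.countP_mono_left fun z _ hz => by simpa using hz))
  have hPt : (askOnce fun _ => .ge γ).prob D {true} = D.real (Ici γ) := by
    simp [prob, expect_askOnce, askProb_ge_const]
  have hPf : (askOnce fun _ => .ge γ).prob D {false} = D.real (Iio γ) := by
    rw [← compl_Ici, probReal_compl_eq_one_sub measurableSet_Ici]
    simp [prob, expect_askOnce, askProb_ge_const]
  have hlen := replicate_always_length (askOnce fun _ => ThresholdQuery.ge γ) n
  by_cases h1 : γ < a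
  · refine le_trans (prob_mono_of_always D hlen fun l hl h => ?_) (htail false ?_)
    · rw [mem_preimage, mem_compl_iff, mem_Icc, if_pos h1, if_pos (h1.trans_le hab)] at h
      rw [mem_ofPred_eq]
      have := List.count_true_add_count_false l
      by_contra hc
      rw [if_pos (by omega)] at h
      exact h ⟨le_rfl, le_rfl⟩
    · rw [hPf]
      exact (measureReal_mono Iio_subset_Iic_self).trans (hle h1)
  by_cases h2 : γ < b
  · rw [if_neg h1, if_pos h2]
    refine le_trans (le_of_eq (prob_eq_zero_of_always D hlen fun l _ => ?_)) (by positivity)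
    rw [mem_preimage, mem_compl_iff, not_not]
    split_ifs <;> simp
  · refine le_trans (prob_mono D _ fun l h => ?_) (htail true ?_)
    · rw [mem_preimage, mem_compl_iff, mem_Icc, if_neg h1, if_neg h2] at h
      rw [mem_ofPred_eq]
      by_contra hc
      rw [if_neg (by omega)] at h
      exact h ⟨le_rfl, le_rfl⟩
    · rw [hPt]
      exact hge (not_lt.1 h2)

theorem sum_ite_lt_le (z : ℝ) (n : ℕ) :
    ∑ j ∈ Finset.range n, (if (j : ℝ) < z then (1 : ℝ) else 0) ≤ max 0 (z + 1) := by
  have h : ∀ m : ℕ, ∑ j ∈ Finset.range m, (if (j : ℝ) < z then (1 : ℝ) else 0) ≤ m := fun m => by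
    refine (Finset.sum_le_card_nsmul _ _ 1 fun j _ => ?_).trans (by simp)
    split_ifs <;> norm_num
  induction n with
  | zero => simp
  | succ n ih =>
    by_cases hn : (n : ℝ) < z
    · refine (h (n + 1)).trans (le_max_of_le_right ?_)
      push_cast
      linarith
    · rw [Finset.sum_range_succ, if_neg hn, add_zero]
      exact ih

theorem min_le_sum_ite_lt (z : ℝ) (n : ℕ) :
    min z n ≤ ∑ j ∈ Finset.range n, (if (j : ℝ) < z then (1 : ℝ) else 0) := by
  induction n with
  | zero => simp
  | succ n ih =>
    rw [Finset.sum_range_succ]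
    by_cases hn : (n : ℝ) < z
    · rw [min_eq_right hn.le] at ih
      rw [if_pos hn]
      push_cast
      exact (min_le_right _ _).trans (by linarith)
    · rw [min_eq_left (not_lt.1 hn)] at ih
      rw [if_neg hn, add_zero]
      exact (min_le_left _ _).trans ih

/-- Starting from a coarse estimate `y` of the mean, with error at most `(M / 2 - 2) σ`, find a
point at distance at most `2 σ` from the mean, by `n` queries at each of `M` grid points. -/
noncomputable def locRefine (M n : ℕ) (σ y : ℝ) : Protocol ℝ :=
  (sumOver (fun j : ℕ => majorityVote n (y - M / 2 * σ + j * σ)) (List.range M)).bind fun K =>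
    .ret (y - M / 2 * σ + K * σ - σ / 2)

theorem oblivious_locRefine (M n : ℕ) (σ y : ℝ) : (locRefine M n σ y).Oblivious :=
  (Oblivious.sumOver (fun _ => oblivious_majorityVote _ _) _).bind fun _ => trivial

theorem usesAtMost_locRefine (M n : ℕ) (σ y : ℝ) : (locRefine M n σ y).UsesAtMost (M * n) :=
  ((usesAtMost_sumOver (fun _ => usesAtMost_majorityVote n _) (List.range M)).bind
    fun _ => usesAtMost_ret _ 0).mono (by simp)

theorem prob_locRefine_le {k lam σ : ℝ} {D : Measure ℝ} (h : InFamily k lam σ D) (hk : 1 < k)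
    (hσ : 0 < σ) (M n : ℕ) {y : ℝ} (hy : |y - distMean D| ≤ (M / 2 - 2) * σ) :
    (locRefine M n σ y).prob D {c | 2 * σ < |c - distMean D|} ≤ M * (17 / 18) ^ n := by
  have := h.1
  set μ := distMean D
  set γ₀ : ℝ := y - M / 2 * σ with hγ₀
  have hvote : ∀ j : ℕ, _ := fun j =>
    prob_majorityVote_le (D := D) (a := μ - 3 / 2 * σ) (b := μ + 3 / 2 * σ) (γ := γ₀ + j * σ)
      (by linarith)
      (fun hj => (h.real_Iic_le hk hσ (s := 3 / 2) (by norm_num) hj.le).trans (by norm_num))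
      (fun hj => (h.real_Ici_le hk hσ (s := 3 / 2) (by norm_num) hj).trans (by norm_num)) n
  have hsum := prob_sumOver_le D (by positivity) hvote (List.range M)
  rw [List.length_range] at hsum
  rw [locRefine, prob_bind_ret]
  refine (prob_mono D _ fun K hK => ?_).trans hsum
  rw [mem_preimage, mem_ofPred_eq, ← not_le] at hK
  rw [mem_compl_iff, sum_map_range, sum_map_range, mem_Icc]
  rintro ⟨hlo, hhi⟩
  refine hK ?_
  have hiff : ∀ (t : ℝ) (j : ℕ), γ₀ + j * σ < t ↔ (j : ℝ) < (t - γ₀) / σ := fun t j => by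
    rw [lt_div_iff₀ hσ]
    constructor <;> intro h <;> linarith
  simp only [hiff] at hlo hhi
  -- Counting grid points puts γ₀ + K σ between μ - 3/2 σ and μ + 5/2 σ, the extra σ being the
  -- rounding of the count. The shift by σ / 2 in `locRefine` centres this window, leaving the error
  -- 2 σ.
  have h1 := (min_le_sum_ite_lt _ M).trans hlo
  have h2 := hhi.trans (sum_ite_lt_le _ M)
  rw [abs_le] at hy
  rw [min_eq_left (by rw [div_le_iff₀ hσ]; linarith), div_le_iff₀ hσ] at h1
  rw [max_eq_right (add_nonneg (div_nonneg (by linarith) hσ.le) zero_le_one),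
    ← sub_le_iff_le_add, le_div_iff₀ hσ] at h2
  rw [abs_le]
  constructor <;> linarith

/-! ### The localization procedure -/

/-- The number of steps of the search, and of votes at each grid point of the refinement. -/
noncomputable def locSteps (lam σ δ : ℝ) : ℕ :=
  ⌈360 * (1 + Real.log (lam / σ) + Real.log (1 / δ))⌉₊

/-- A point that is close to the mean with high probability. -/
noncomputable def locCenter (lam σ δ : ℝ) : Protocol ℝ :=
  (locWalk (16384 * σ) (locSteps lam σ δ) (0, lam + 16384 * σ)).bind fun l =>
    locRefine 65536 (locSteps lam σ δ) σ (listMedian l)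

/-- The localization procedure. -/
noncomputable def localizer (lam σ δ : ℝ) : Protocol (ℝ × ℝ) :=
  (locCenter lam σ δ).bind fun c => .ret (c - 3 * σ, c + 3 * σ)

theorem oblivious_locCenter (lam σ δ : ℝ) : (locCenter lam σ δ).Oblivious := by
  rw [locCenter]
  generalize 65536 = M
  exact (oblivious_locWalk _ _ _).bind fun l => oblivious_locRefine _ _ _ _

theorem oblivious_localizer (lam σ δ : ℝ) : (localizer lam σ δ).Oblivious :=
  (oblivious_locCenter _ _ _).bind fun _ => trivial

theorem usesAtMost_localizer (lam σ δ : ℝ) :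
    (localizer lam σ δ).UsesAtMost (65539 * locSteps lam σ δ) :=
  (((usesAtMost_locWalk _ _ _).bind fun _ => usesAtMost_locRefine _ _ _ _).bind
    fun _ => usesAtMost_ret _ 0).mono (by omega)

theorem locSteps_le {lam σ δ : ℝ} (hσ : 0 < σ) (hlam : σ ≤ lam) (hδ : 0 < δ) (hδ1 : δ < 1) :
    (locSteps lam σ δ : ℝ) ≤ 361 * (1 + Real.log (lam / σ) + Real.log (1 / δ)) := by
  have ha : 0 ≤ Real.log (lam / σ) := Real.log_nonneg ((one_le_div hσ).2 hlam)
  have hb : 0 ≤ Real.log (1 / δ) := Real.log_nonneg ((one_le_div hδ).2 hδ1.le)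
  have := Nat.ceil_lt_add_one (a := 360 * (1 + Real.log (lam / σ) + Real.log (1 / δ)))
    (by positivity)
  unfold locSteps
  linarith

/-- The factor σ / lam pays for the initial potential, of order lam / σ, and 2^(-18) = 1 / (4 ·
65536) for the union bound over the grid. The exponent 360 / 20 = 18 gives both. -/
theorem pow_locSteps_le {lam σ δ q : ℝ} (hσ : 0 < σ) (hlam : σ ≤ lam) (hδ : 0 < δ) (hδ1 : δ < 1)
    (hq0 : 0 ≤ q) (hq : q ≤ 1 - 1 / 20) :
    q ^ locSteps lam σ δ ≤ 1 / 2 ^ 18 * (σ / lam * δ) := by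
  have hlam0 : 0 < lam := hσ.trans_le hlam
  set a := Real.log (lam / σ) with hadef
  set b := Real.log (1 / δ) with hbdef
  have ha : 0 ≤ a := Real.log_nonneg ((one_le_div hσ).2 hlam)
  have hb : 0 ≤ b := Real.log_nonneg ((one_le_div hδ).2 hδ1.le)
  have hN : 360 * (1 + a + b) ≤ (locSteps lam σ δ : ℝ) := Nat.le_ceil _
  have h1 : q ≤ Real.exp (-(1 / 20)) := by
    have := Real.add_one_le_exp (-(1 / 20) : ℝ)
    linarith
  have h2 : Real.exp (-18) ≤ 1 / 2 ^ 18 := by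
    rw [Real.exp_neg, ← one_div]
    apply one_div_le_one_div_of_le (by positivity)
    have h3 : (2 : ℝ) ≤ Real.exp 1 := by
      have := Real.add_one_le_exp (1 : ℝ)
      linarith
    calc (2 : ℝ) ^ 18 ≤ Real.exp 1 ^ 18 := pow_le_pow_left₀ (by norm_num) h3 18
      _ = Real.exp 18 := by rw [← Real.exp_nat_mul]; norm_num
  have h3 : σ / lam = Real.exp (-a) := by
    rw [Real.exp_neg, hadef, Real.exp_log (by positivity), inv_div]
  have h4 : δ = Real.exp (-b) := by
    rw [Real.exp_neg, hbdef, Real.exp_log (by positivity), inv_div, div_one]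
  calc q ^ locSteps lam σ δ ≤ Real.exp (-(1 / 20)) ^ locSteps lam σ δ :=
        pow_le_pow_left₀ hq0 h1 _
    _ = Real.exp (locSteps lam σ δ * (-(1 / 20))) := by rw [← Real.exp_nat_mul]
    _ ≤ Real.exp (-18 + (-a + -b)) := Real.exp_le_exp.2 (by linarith)
    _ = Real.exp (-18) * (σ / lam * δ) := by rw [Real.exp_add, Real.exp_add, h3, ← h4]
    _ ≤ _ := by gcongr

theorem prob_locCenter_le {k lam σ δ : ℝ} {D : Measure ℝ} (h : InFamily k lam σ D) (hk : 1 < k)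
    (hσ : 0 < σ) (hlam : σ ≤ lam) (hδ : 0 < δ) (hδ1 : δ < 1) :
    (locCenter lam σ δ).prob D {c | 2 * σ < |c - distMean D|} ≤ δ / 2 := by
  have := h.1
  have hlam0 : 0 < lam := hσ.trans_le hlam
  have hmean := h.3
  set μ := distMean D
  -- The resolution w = 128 σ makes the tails at most 1/256, and ℓ₀ = 16384 σ = 128 w. The resulting
  -- error 16512 σ is well within the reach (65536 / 2 - 2) σ of the refinement.
  have hgood := prob_listMedian_locWalk_le (D := D) (μ := μ) (w := 128 * σ)
    (fun γ hγ => (h.real_Ici_le hk hσ (s := 128) (by norm_num) hγ).trans (by norm_num))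
    (fun γ hγ => (h.real_Iic_le hk hσ (s := 128) (by norm_num) hγ).trans (by norm_num))
    (by positivity) (ℓ₀ := 16384 * σ) (by linarith) (locSteps lam σ δ)
    (s := (0, lam + 16384 * σ)) (by simp only; linarith)
  have hrefine : ∀ l, l ∉ {l : List ℝ | 16384 * σ + 128 * σ < |listMedian l - μ|} →
      (locRefine 65536 (locSteps lam σ δ) σ (listMedian l)).prob D {c | 2 * σ < |c - μ|} ≤
        δ / 4 := by
    intro l hl
    rw [mem_ofPred_eq, not_lt] at hl
    refine (prob_locRefine_le h hk hσ _ _ (hl.trans ?_)).trans ?_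
    · push_cast
      linarith
    · have h1 := pow_locSteps_le (q := 17 / 18) hσ hlam hδ hδ1 (by norm_num) (by norm_num)
      have h2 : σ / lam * δ ≤ δ := mul_le_of_le_one_left hδ.le ((div_le_one hlam0).2 hlam)
      push_cast
      linarith
  have hbind := prob_bind_le D (locWalk (16384 * σ) (locSteps lam σ δ) (0, lam + 16384 * σ)) _ _ _
    (by positivity) hrefine
  refine hbind.trans ?_
  suffices hw : (19 / 20) ^ locSteps lam σ δ *
      (locPotential μ (0, lam + 16384 * σ) / (3 / 4 * (16384 * σ))) ≤ δ / 4 by linarith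
  have hV : locPotential μ (0, lam + 16384 * σ) ≤ 2 * (lam + 16384 * σ) := by
    have h1 : μ ^ 2 ≤ lam ^ 2 := by
      rw [← sq_abs]
      exact pow_le_pow_left₀ (abs_nonneg _) hmean 2
    refine max_le (by simp only; linarith) ?_
    simp only
    rw [div_le_iff₀ (by positivity)]
    nlinarith
  have hV2 : locPotential μ (0, lam + 16384 * σ) / (3 / 4 * (16384 * σ)) ≤ 8 * (lam / σ) := by
    rw [div_le_iff₀ (by positivity)]
    have : 8 * (lam / σ) * (3 / 4 * (16384 * σ)) = 8 * (3 / 4) * 16384 * lam := by field_simp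
    rw [this]
    linarith
  have h1 := pow_locSteps_le (q := 19 / 20) hσ hlam hδ hδ1 (by norm_num) (by norm_num)
  have hV0 := (locPotential_pos (μ := μ) (s := (0, lam + 16384 * σ)) (by positivity)).le
  calc _ ≤ 1 / 2 ^ 18 * (σ / lam * δ) * (8 * (lam / σ)) := by gcongr
    _ = 8 / 2 ^ 18 * δ := by field_simp
    _ ≤ δ / 4 := by linarith

theorem isLocalizer_localizer : IsLocalizer localizer := by
  refine ⟨65539 * 361, by norm_num, fun lam σ δ hσ hlam hδ hδ1 => ⟨fun ω => ?_, ?_⟩⟩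
  · have h1 : ((localizer lam σ δ).samples ω : ℝ) ≤ ((65539 * locSteps lam σ δ : ℕ) : ℝ) :=
      Nat.cast_le.2 (usesAtMost_localizer lam σ δ ω)
    have h2 := locSteps_le hσ hlam hδ hδ1
    push_cast at h1
    linarith
  · intro k hk D hD
    have := hD.1
    have h1 := streamLaw_output D (oblivious_localizer lam σ δ)
      {LU | ¬ ((∀ m, IsMedian D m → m ∈ Icc LU.1 LU.2) ∧ LU.2 + σ - (LU.1 - σ) ≤ 8 * σ)}
    refine le_trans (le_of_eq h1) (ENNReal.ofReal_le_ofReal ?_)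
    rw [localizer, prob_bind_ret]
    refine (prob_mono D _ fun c hc => ?_).trans (prob_locCenter_le hD hk hσ hlam hδ hδ1)
    rw [mem_preimage, mem_ofPred_eq] at hc
    rw [mem_ofPred_eq]
    by_contra hcon
    rw [not_lt, abs_le] at hcon
    -- Medians are within σ of the mean and the centre within 2 σ, whence the radius 3 σ; padding by
    -- σ on both sides gives length exactly 8 σ.
    refine hc ⟨fun m hm => ?_, by simp only; linarith⟩
    have := hD.abs_median_sub_mean_le hk hσ hm
    rw [abs_le] at this
    constructor <;> simp only <;> linarith

/-! ### The estimator for a known scale -/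

theorem oblivious_frequency {q : unitInterval → ThresholdQuery} {g : unitInterval → ℝ}
    (hg : Measurable g) (hq : (∀ u, q u = .le (g u)) ∨ ∀ u, q u = .ge (g u)) (n : ℕ) :
    (frequency q n).Oblivious :=
  (Oblivious.replicate (p := askOnce q)
    ⟨measurableSet_answer hg hq, fun _ _ => rfl, fun _ _ => trivial⟩ n).bind fun _ => trivial

theorem oblivious_localEstimate (c a b : ℝ) (n : ℕ) : (localEstimate c a b n).Oblivious := by
  have hm : Measurable fun u : unitInterval => c + (a + (b - a) * (u : ℝ)) := by fun_prop
  refine (oblivious_frequency measurable_const (Or.inr fun _ => rfl) n).bind fun _ => ?_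
  refine (oblivious_frequency hm (Or.inr fun _ => rfl) n).bind fun _ => ?_
  refine (oblivious_frequency measurable_const (Or.inr fun _ => rfl) n).bind fun _ => ?_
  refine (oblivious_frequency hm (Or.inl fun _ => rfl) n).bind fun _ => ?_
  trivial

theorem usesAtMost_localEstimate (c a b : ℝ) (n : ℕ) :
    (localEstimate c a b n).UsesAtMost (4 * n) :=
  ((usesAtMost_frequency _ n).bind fun _ => (usesAtMost_frequency _ n).bind fun _ =>
    (usesAtMost_frequency _ n).bind fun _ => (usesAtMost_frequency _ n).bind fun _ =>
    usesAtMost_ret _ 0).mono (by omega)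

theorem oblivious_baseEstimate (A B k σ ε c : ℝ) : (baseEstimate A B k σ ε c).Oblivious := by
  refine Oblivious.sumOver (fun _ => ?_) _
  refine (oblivious_localEstimate _ _ _ _).bind fun _ => ?_
  exact (oblivious_localEstimate _ _ _ _).bind fun _ => trivial

theorem usesAtMost_baseEstimate (A B k σ ε c : ℝ) :
    (baseEstimate A B k σ ε c).UsesAtMost
      (∑ j ∈ Finset.range (numRegions A k σ ε), 8 * allocation B k σ ε (j + 1)) := by
  have h := usesAtMost_sumOver (fun j : ℕ => UsesAtMost.mono
    ((usesAtMost_localEstimate c (gridPoint j * σ) (gridPoint (j + 1) * σ)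
      (allocation B k σ ε (j + 1))).bind fun x =>
      (usesAtMost_localEstimate c (-(gridPoint (j + 1) * σ)) (-(gridPoint j * σ))
        (allocation B k σ ε (j + 1))).bind fun y => usesAtMost_ret (x + y) 0)
    (show _ ≤ 8 * allocation B k σ ε (j + 1) by omega)) (List.range (numRegions A k σ ε))
  refine h.mono (le_of_eq ?_)
  induction numRegions A k σ ε with
  | zero => rfl
  | succ n ih => rw [List.range_succ, List.map_append, List.sum_append, ih,
      Finset.sum_range_succ]; simp

theorem oblivious_meanEstimator (A B k lam σ ε δ : ℝ) :
    (meanEstimator localizer A B k lam σ ε δ).Oblivious :=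
  (oblivious_localizer _ _ _).bind fun _ =>
    (Oblivious.replicate (oblivious_baseEstimate _ _ _ _ _ _) _).bind fun _ => trivial

theorem usesAtMost_meanEstimator (A B k lam σ ε δ : ℝ) :
    (meanEstimator localizer A B k lam σ ε δ).UsesAtMost
      (65539 * locSteps lam σ δ + ⌈8 * Real.log (2 / δ)⌉₊ *
        ∑ j ∈ Finset.range (numRegions A (min k 3) σ ε), 8 * allocation B (min k 3) σ ε (j + 1)) :=
  (usesAtMost_localizer _ _ _).bind fun _ =>
    ((usesAtMost_baseEstimate _ _ _ _ _ _).replicate _).bind fun _ => usesAtMost_ret _ 0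

theorem prob_meanEstimator_le {k lam σ ε δ : ℝ} {D : Measure ℝ} (h : InFamily k lam σ D)
    (hk : 1 < k) (hlam : σ ≤ lam) (hε : 0 < ε) (hεσ : ε ≤ σ) (hδ : 0 < δ) (hδ1 : δ < 1) :
    (meanEstimator localizer (cutoffConst (min k 3)) 200000 k lam σ ε δ).prob D
      {x | ε < |x - distMean D|} ≤ δ := by
  have := h.1
  have hσ : 0 < σ := hε.trans_le hεσ
  have hloc := prob_locCenter_le h hk hσ hlam hδ hδ1
  rw [meanEstimator, localizer, bind_assoc]
  -- Half of δ goes to the localization. What is used is the distance of its centre from the mean,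
  -- which is recovered as the midpoint of the interval.
  refine (prob_bind_le D _ _ {c | 2 * σ < |c - distMean D|} _ (e := δ / 2) (by positivity)
    fun c hc => ?_).trans (by linarith)
  rw [mem_ofPred_eq, not_lt] at hc
  rw [ret_bind, prob_bind_ret]
  simp only
  rw [show (c - 3 * σ + (c + 3 * σ)) / 2 = c by ring]
  have hbase := prob_baseEstimate_le h (lt_min hk (by norm_num)) (min_le_right k 3)
    (min_le_left k 3) hε hεσ hc
  have hmed := prob_listMedian_replicate_le D _ hbase (n := ⌈8 * Real.log (2 / δ)⌉₊)
  refine (prob_mono D _ fun l hl => ?_).trans (hmed.trans ?_)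
  · rw [mem_preimage, mem_ofPred_eq] at hl
    rw [mem_ofPred_eq]
    convert hl using 2
    ring
  -- 8 log(2 / δ) runs at rate e^(-1/8) give the other δ / 2.
  · have h1 : (7 / 8 : ℝ) ≤ Real.exp (-(1 / 8)) := by
      have := Real.add_one_le_exp (-(1 / 8) : ℝ)
      linarith
    have h2 : 8 * Real.log (2 / δ) ≤ (⌈8 * Real.log (2 / δ)⌉₊ : ℝ) := Nat.le_ceil _
    calc (7 / 8 : ℝ) ^ ⌈8 * Real.log (2 / δ)⌉₊ ≤
          Real.exp (-(1 / 8)) ^ ⌈8 * Real.log (2 / δ)⌉₊ := pow_le_pow_left₀ (by norm_num) h1 _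
      _ = Real.exp (⌈8 * Real.log (2 / δ)⌉₊ * (-(1 / 8))) := by rw [← Real.exp_nat_mul]
      _ ≤ Real.exp (-Real.log (2 / δ)) := Real.exp_le_exp.2 (by linarith)
      _ = δ / 2 := by rw [Real.exp_neg, Real.exp_log (by positivity), inv_div]

/-! ### The grid search -/

theorem oblivious_gridLoop {est : ℕ → Protocol ℝ} (hest : ∀ i, (est i).Oblivious) (eps : ℕ → ℝ)
    (n i : ℕ) (prev : List (ℝ × ℝ)) (last : ℝ) : (gridLoop est eps n i prev last).Oblivious := by
  induction n generalizing i prev last with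
  | zero => trivial
  | succ n ih =>
    refine (hest i).bind fun x => ?_
    split_ifs
    · trivial
    · exact ih _ _ _

theorem usesAtMost_gridLoop {est : ℕ → Protocol ℝ} (eps : ℕ → ℝ) {N n i : ℕ}
    (hest : ∀ j < i + n, (est j).UsesAtMost N) (prev : List (ℝ × ℝ)) (last : ℝ) :
    (gridLoop est eps n i prev last).UsesAtMost (n * N) := by
  induction n generalizing i prev last with
  | zero => exact usesAtMost_ret _ _
  | succ n ih =>
    refine UsesAtMost.mono ((hest i (by omega)).bind (n := n * N) fun x => ?_)
      (le_of_eq (by ring))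
    split_ifs
    · exact usesAtMost_ret _ _
    · exact ih (fun j hj => hest j (by omega)) _ _

/-- Once a correct interval has been found, all later outputs are close to the target. -/
theorem gridLoop_always (est : ℕ → Protocol ℝ) {eps : ℕ → ℝ} {μ : ℝ} {J : ℝ × ℝ}
    (hJ : |J.1 - μ| ≤ J.2) {n i : ℕ} (heps : ∀ j, i ≤ j → eps j ≤ J.2) {prev : List (ℝ × ℝ)}
    (hprev : J ∈ prev) {last : ℝ} (hlast : |last - μ| ≤ 3 * J.2) :
    (gridLoop est eps n i prev last).Always fun x => |x - μ| ≤ 3 * J.2 := by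
  induction n generalizing i prev last with
  | zero => exact hlast
  | succ n ih =>
    refine (always_of_forall (Q := fun _ => True) (fun _ => trivial) (est i)).bind fun x _ => ?_
    split_ifs with h
    · exact hlast
    · refine ih (fun j hj => heps j (by omega)) (List.mem_cons_of_mem _ hprev) ?_
      push Not at h
      -- Through a common point y, the distance from x to μ is at most `eps i` + 2 `J.2`, hence at
      -- most 3 `J.2`.
      obtain ⟨y, hy1, hy2⟩ := h J hprev
      have h1 := heps i le_rfl
      rw [abs_le] at hJ ⊢
      constructor <;> linarith [hy1.1, hy1.2, hy2.1, hy2.2]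

theorem prob_gridLoop_le {D : Measure ℝ} [IsProbabilityMeasure D] {est : ℕ → Protocol ℝ}
    {eps : ℕ → ℝ} {μ e : ℝ} (he : 0 ≤ e) {m n i : ℕ}
    (heps : ∀ j, i + m ≤ j → eps j ≤ eps (i + m))
    (hest : ∀ j, i ≤ j → j ≤ i + m → (est j).prob D {x | eps j < |x - μ|} ≤ e)
    {prev : List (ℝ × ℝ)} (hprev : ∀ J ∈ prev, |J.1 - μ| ≤ J.2) (last : ℝ) :
    (gridLoop est eps (m + 1 + n) i prev last).prob D {x | 3 * eps (i + m) < |x - μ|} ≤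
      (m + 1) * e := by
  have hmeet : ∀ x, |x - μ| ≤ eps i → ¬ ∃ J ∈ prev,
      Icc (x - eps i) (x + eps i) ∩ Icc (J.1 - J.2) (J.1 + J.2) = ∅ := by
    rintro x hx ⟨J, hJ, hempty⟩
    have h1 := hprev J hJ
    rw [abs_le] at hx h1
    have : μ ∈ Icc (x - eps i) (x + eps i) ∩ Icc (J.1 - J.2) (J.1 + J.2) :=
      ⟨⟨by linarith, by linarith⟩, ⟨by linarith, by linarith⟩⟩
    rw [hempty] at this
    exact this
  -- The induction is on the number of guaranteed rounds before round i + m. After that round the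
  -- interval found there controls every later output deterministically, so the n extra rounds cost
  -- no probability.
  induction m generalizing i prev last with
  | zero =>
    rw [show 0 + 1 + n = n + 1 by omega, gridLoop]
    refine (prob_bind_le D (est i) _ {x | eps i < |x - μ|} _ le_rfl fun x hx => ?_).trans
      (by simpa using hest i le_rfl (by omega))
    rw [mem_ofPred_eq, not_lt] at hx
    rw [if_neg (hmeet x hx)]
    have h0 : 0 ≤ eps i := (abs_nonneg _).trans hx
    refine le_of_eq (prob_eq_zero_of_always D
      (gridLoop_always est (J := (x, eps i)) hx (fun j hj => heps j (by omega))
        List.mem_cons_self (by simp only; linarith)) fun y hy => ?_)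
    rw [mem_ofPred_eq, not_lt]
    exact hy
  | succ m ih =>
    rw [show m + 1 + 1 + n = (m + 1 + n) + 1 by omega, gridLoop]
    have h1 := prob_bind_le D (est i) (fun x => open Classical in
      if ∃ J ∈ prev, Icc (x - eps i) (x + eps i) ∩ Icc (J.1 - J.2) (J.1 + J.2) = ∅ then
        .ret last
      else gridLoop est eps (m + 1 + n) (i + 1) ((x, eps i) :: prev) x)
      {x | eps i < |x - μ|} {x | 3 * eps (i + (m + 1)) < |x - μ|} (e := (m + 1) * e)
      (by positivity) fun x hx => by
        rw [mem_ofPred_eq, not_lt] at hx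
        rw [if_neg (hmeet x hx)]
        have hprev' : ∀ J ∈ (x, eps i) :: prev, |J.1 - μ| ≤ J.2 := by
          intro J hJ
          rcases List.mem_cons.1 hJ with rfl | hJ
          · exact hx
          · exact hprev J hJ
        have hidx : i + (m + 1) = i + 1 + m := by omega
        rw [hidx] at heps ⊢
        refine ih heps (fun j hj1 hj2 => hest j (by omega) (by omega)) hprev' x ?_
        rintro y hy ⟨J, hJ, hempty⟩
        have h2 := hprev' J hJ
        rw [abs_le] at hy h2
        have : μ ∈ Icc (y - eps (i + 1)) (y + eps (i + 1)) ∩ Icc (J.1 - J.2) (J.1 + J.2) :=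
          ⟨⟨by linarith, by linarith⟩, ⟨by linarith, by linarith⟩⟩
        rw [hempty] at this
        exact this
    refine h1.trans ?_
    have := hest i le_rfl (by omega)
    push_cast
    linarith

/-! ### The accuracy of the scale-adaptive estimator -/

theorem guess_pos {σmax : ℝ} (h : 0 < σmax) (i : ℕ) : 0 < guess σmax i := by
  unfold guess
  positivity

theorem guess_antitone {σmax : ℝ} (h : 0 < σmax) : Antitone (guess σmax) := fun i j hij => by
  unfold guess
  gcongr
  norm_num

theorem guess_lastIndex_le {σmin σmax : ℝ} (h0 : 0 < σmin) (h1 : σmin ≤ σmax) :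
    guess σmax (lastIndex σmin σmax) ≤ σmin := by
  have hmax : 0 < σmax := h0.trans_le h1
  rw [guess, div_le_iff₀ (by positivity), ← div_le_iff₀' h0, ← Real.rpow_natCast]
  calc σmax / σmin = 2 ^ Real.logb 2 (σmax / σmin) :=
        (Real.rpow_logb (by norm_num) (by norm_num) (by positivity)).symm
    _ ≤ _ := Real.rpow_le_rpow_of_exponent_le (by norm_num) (Nat.le_ceil _)

/-- The last guess that is at least the true scale is at most twice the true scale. -/
theorem exists_guess_index {σmin σmax σ : ℝ} (h0 : 0 < σmin) (h1 : σmin ≤ σ) (h2 : σ ≤ σmax) :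
    ∃ m ≤ lastIndex σmin σmax, σ ≤ guess σmax m ∧ guess σmax m ≤ 2 * σ := by
  classical
  have hmax : 0 < σmax := by linarith
  have hT := guess_lastIndex_le h0 (h1.trans h2)
  set m := Nat.findGreatest (fun i => σ ≤ guess σmax i) (lastIndex σmin σmax) with hm
  have hle : m ≤ lastIndex σmin σmax := Nat.findGreatest_le _
  have hspec : σ ≤ guess σmax m :=
    Nat.findGreatest_spec (P := fun i => σ ≤ guess σmax i) (Nat.zero_le _) (by simpa [guess] using h2)
  refine ⟨m, hle, hspec, ?_⟩
  -- At the last index the guess is already at most σmin; otherwise, by maximality, the next guess,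
  -- half as large, is below σ.
  rcases hle.eq_or_lt with heq | hlt
  · rw [heq]
    linarith
  · have := Nat.findGreatest_is_greatest (P := fun i => σ ≤ guess σmax i)
      (n := lastIndex σmin σmax) (k := m + 1) (by omega) (by omega)
    rw [not_le] at this
    have h3 : guess σmax m = 2 * guess σmax (m + 1) := by
      simp only [guess, pow_succ]
      field_simp
    linarith

theorem isPAC_scaleAdaptiveEstimator {k lam σmin σmax r δ σ : ℝ} (hk : 1 < k) (h0 : 0 < σmin)
    (hσ : σ ∈ Icc σmin σmax) (hlam : σmax ≤ lam) (hr : 0 < r) (hr1 : r < 1) (hδ : 0 < δ)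
    (hδ1 : δ < 1) :
    IsPAC (scaleAdaptiveEstimator localizer (cutoffConst (min k 3)) 200000 k lam σmin σmax r δ)
      (r * σ) δ (InFamily k lam σ) := by
  intro D hD
  have := hD.1
  have hmax : 0 < σmax := by linarith [hσ.1, hσ.2]
  have hσ0 : 0 < σ := by linarith [hσ.1]
  set T := lastIndex σmin σmax with hT
  have hobl : (scaleAdaptiveEstimator localizer (cutoffConst (min k 3)) 200000 k lam σmin σmax r
      δ).Oblivious := oblivious_gridLoop (fun _ => oblivious_meanEstimator _ _ _ _ _ _ _) _ _ _ _ _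
  refine le_trans (le_of_eq (streamLaw_output D hobl {x | r * σ < |x - distMean D|}))
    (ENNReal.ofReal_le_ofReal ?_)
  obtain ⟨m, hmT, hm1, hm2⟩ := exists_guess_index h0 hσ.1 hσ.2
  rw [← hT] at hmT
  have hδ' : 0 < δ / (T + 1) := by positivity
  have hδ1' : δ / (T + 1) < 1 := by
    rw [div_lt_one (by positivity)]
    have : (0 : ℝ) ≤ T := Nat.cast_nonneg T
    linarith
  have hloop := prob_gridLoop_le (D := D) (μ := distMean D)
    (est := fun i => meanEstimator localizer (cutoffConst (min k 3)) 200000 k lam (guess σmax i)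
      (r * guess σmax i / 6) (δ / (T + 1)))
    (eps := fun i => r * guess σmax i / 6) hδ'.le (m := m) (n := T - m) (i := 0) (prev := [])
    (fun j hj => by
      have := guess_antitone hmax hj
      gcongr)
    (fun j _ hj => by
      have hj' := guess_antitone hmax (show j ≤ m by omega)
      have hg := guess_pos hmax j
      -- Up to round m the guess is at least the true scale, so the distribution belongs to the
      -- family of that guess.
      refine prob_meanEstimator_le (hD.mono_scale hk hσ0 (hm1.trans hj')) hk ?_ (by positivity)
        (by nlinarith) hδ' hδ1'
      refine le_trans (guess_antitone hmax (Nat.zero_le j)) ?_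
      simpa [guess] using hlam)
    (by simp) 0
  rw [show m + 1 + (T - m) = T + 1 by omega] at hloop
  refine (prob_mono D _ fun x hx => ?_).trans (hloop.trans ?_)
  · rw [mem_ofPred_eq] at hx ⊢
    -- 3 ε_m = r σ_m / 2 ≤ r σ, because σ_m ≤ 2 σ.
    refine lt_of_le_of_lt ?_ hx
    rw [zero_add]
    nlinarith
  · have hmT' : (m : ℝ) ≤ T := Nat.cast_le.2 hmT
    rw [mul_div_assoc', div_le_iff₀ (by positivity), mul_comm]
    gcongr

/-! ### The number of samples -/

theorem one_le_logPlus (x : ℝ) : 1 ≤ logPlus x := le_max_left _ _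

theorem half_le_log_two : (1 : ℝ) / 2 ≤ Real.log 2 := by
  have := Real.log_two_gt_d9
  linarith

theorem logb_two_le {x : ℝ} (hx : 1 ≤ x) : Real.logb 2 x ≤ 2 * Real.log x := by
  have h0 := Real.log_nonneg hx
  have h2 := half_le_log_two
  rw [Real.logb, div_le_iff₀ (by linarith)]
  nlinarith

theorem one_le_refinementRate {k r : ℝ} (hk : 1 < k) (hr : 0 < r) (hr1 : r < 1) :
    1 ≤ refinementRate k r := by
  have h1 : 1 ≤ 1 / r ^ 2 := by
    rw [one_le_div (by positivity)]
    exact pow_le_one₀ hr.le hr1.le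
  unfold refinementRate
  split_ifs
  · exact h1
  · exact one_le_mul_of_one_le_of_one_le h1 (one_le_logPlus _)
  · exact Real.one_le_rpow ((one_le_div hr).2 hr1.le) (div_nonneg (by linarith) (by linarith))

/-! ### The number of samples of one base estimate. -/

section BaseSamples

variable {A B p σ ε r : ℝ}

theorem cutoff_div (hσ : 0 < σ) (h : σ / ε = 6 / r) :
    cutoff A p σ ε / σ = A * (6 / r) ^ (1 / (p - 1)) := by
  rw [cutoff, h]
  field_simp

theorem one_le_cutoff_ratio (hA : 1 < A) (hp : 1 < p) (hr : 0 < r) (hr1 : r < 1) :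
    1 ≤ A * (6 / r) ^ (1 / (p - 1)) :=
  one_le_mul_of_one_le_of_one_le hA.le (Real.one_le_rpow
    ((one_le_div hr).2 (by linarith)) (one_div_nonneg.2 (by linarith)))

theorem numRegions_lt (hA : 1 < A) (hp : 1 < p) (hσ : 0 < σ) (hr : 0 < r) (hr1 : r < 1)
    (h : σ / ε = 6 / r) :
    (numRegions A p σ ε : ℝ) < Real.logb 2 (A * (6 / r) ^ (1 / (p - 1))) + 1 := by
  rw [numRegions, cutoff_div hσ h]
  exact Nat.ceil_lt_add_one (Real.logb_nonneg (by norm_num) (one_le_cutoff_ratio hA hp hr hr1))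

theorem numRegions_le (hA : 1 < A) (hp : 1 < p) (hσ : 0 < σ) (hr : 0 < r) (hr1 : r < 1)
    (h : σ / ε = 6 / r) :
    (numRegions A p σ ε : ℝ) ≤ 3 * (A * (6 / r) ^ (1 / (p - 1))) := by
  have h1 := numRegions_lt hA hp hσ hr hr1 h
  have hX := one_le_cutoff_ratio hA hp hr hr1
  have h2 := logb_two_le hX
  have h3 := Real.log_le_sub_one_of_pos (zero_lt_one.trans_le hX)
  linarith

/-- The additive n comes from rounding up the allocation in each region. -/
theorem sum_allocation_le (hB : 0 < B) (h : σ / ε = 6 / r) (n : ℕ) :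
    ((∑ j ∈ Finset.range n, 8 * allocation B p σ ε (j + 1) : ℕ) : ℝ) ≤
      8 * (B * (6 / r) ^ 2 * ∑ j ∈ Finset.range n, ((2 : ℝ) ^ (2 - p)) ^ (j + 1) + n) := by
  push_cast
  rw [← Finset.mul_sum]
  refine mul_le_mul_of_nonneg_left ?_ (by norm_num)
  have hterm : ∀ j ∈ Finset.range n, (allocation B p σ ε (j + 1) : ℝ) ≤
      B * (6 / r) ^ 2 * ((2 : ℝ) ^ (2 - p)) ^ (j + 1) + 1 := by
    intro j _
    refine (Nat.ceil_lt_add_one (by positivity)).le.trans (le_of_eq ?_)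
    rw [h, mul_comm ((j + 1 : ℕ) : ℝ), Real.rpow_mul (by norm_num), Real.rpow_natCast]
    ring
  refine (Finset.sum_le_sum hterm).trans (le_of_eq ?_)
  rw [Finset.sum_add_distrib, ← Finset.mul_sum]
  simp

end BaseSamples

/-- The three rates come from the geometric sum of 2^(i(2-κ)): for k < 2 its last term dominates,
for k = 2 all terms are equal and their number is logarithmic in 1 / r, and for k > 2 it converges.
-/
theorem exists_base_samples_le {k A B : ℝ} (hk : 1 < k) (hA : 1 < A) (hB : 0 < B) :
    ∃ C : ℝ, 0 < C ∧ ∀ σ ε r : ℝ, 0 < σ → 0 < r → r < 1 → σ / ε = 6 / r →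
      ((∑ j ∈ Finset.range (numRegions A (min k 3) σ ε),
        8 * allocation B (min k 3) σ ε (j + 1) : ℕ) : ℝ) ≤ C * refinementRate k r := by
  have hA0 : 0 < A := by linarith
  rcases lt_trichotomy k 2 with hk2 | rfl | hk2
  · have hmin : min k 3 = k := min_eq_left (by linarith)
    rw [hmin]
    set θ : ℝ := 2 ^ (2 - k) with hθ
    have hθ1 : 1 < θ := Real.one_lt_rpow (by norm_num) (by linarith)
    refine ⟨8 * (B * (θ * (2 * A) ^ (2 - k) / (θ - 1)) + 3 * A) * 6 ^ (k / (k - 1)),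
      by have : 0 < θ - 1 := by linarith
         positivity, fun σ ε r hσ hr hr1 h => ?_⟩
    refine (sum_allocation_le hB h _).trans ?_
    set s := 6 / r with hs
    have hs1 : 1 ≤ s := (one_le_div hr).2 (by linarith)
    have hs0 : 0 < s := by linarith
    set I := numRegions A k σ ε with hI
    have hI1 := numRegions_le hA hk hσ hr hr1 h
    have hk1 : 0 < k - 1 := by linarith
    have hI2 : (I : ℝ) ≤ 3 * A * s ^ (k / (k - 1)) := by
      refine hI1.trans ?_
      rw [← mul_assoc]
      gcongr
    have hgeom : ∑ j ∈ Finset.range I, θ ^ (j + 1) ≤ θ * θ ^ I / (θ - 1) := by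
      rw [le_div_iff₀ (by linarith)]
      have h1 := geom_sum_mul θ I
      calc _ = θ * ((∑ j ∈ Finset.range I, θ ^ j) * (θ - 1)) := by
            rw [← mul_assoc, Finset.mul_sum]
            congr 1
            exact Finset.sum_congr rfl fun j _ => by ring
        _ ≤ _ := by rw [h1]; nlinarith
    have hX := one_le_cutoff_ratio hA hk hr hr1
    have hpowI : θ ^ I ≤ (2 * A) ^ (2 - k) * s ^ ((2 - k) / (k - 1)) := by
      have h2I : (2 : ℝ) ^ (I : ℝ) ≤ 2 * (A * s ^ (1 / (k - 1))) := by
        calc (2 : ℝ) ^ (I : ℝ) ≤ 2 ^ (Real.logb 2 (A * s ^ (1 / (k - 1))) + 1) :=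
              Real.rpow_le_rpow_of_exponent_le (by norm_num) (numRegions_lt hA hk hσ hr hr1 h).le
          _ = _ := by
              rw [Real.rpow_add (by norm_num), Real.rpow_logb (by norm_num) (by norm_num)
                (by positivity), Real.rpow_one]
              ring
      calc θ ^ I = ((2 : ℝ) ^ (I : ℝ)) ^ (2 - k) := by
            rw [hθ, ← Real.rpow_natCast, ← Real.rpow_mul (by norm_num),
              ← Real.rpow_mul (by norm_num), mul_comm]
        _ ≤ (2 * (A * s ^ (1 / (k - 1)))) ^ (2 - k) :=
            Real.rpow_le_rpow (by positivity) h2I (by linarith)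
        _ = _ := by
            rw [← mul_assoc, Real.mul_rpow (by positivity) (by positivity),
              ← Real.rpow_mul hs0.le]
            congr 2
            ring
    -- The last region costs s² times (cutoff / σ)^(2-k), up to constants, and 2 + (2 - k) / (k - 1)
    -- = k / (k - 1).
    have hexp : s ^ 2 * s ^ ((2 - k) / (k - 1)) = s ^ (k / (k - 1)) := by
      rw [← Real.rpow_natCast, ← Real.rpow_add hs0]
      congr 1
      field_simp
      push_cast
      ring
    have hrate : refinementRate k r = (1 / r) ^ (k / (k - 1)) := by
      rw [refinementRate, if_neg (by linarith), if_neg (by linarith)]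
    have hs6 : s ^ (k / (k - 1)) = 6 ^ (k / (k - 1)) * (1 / r) ^ (k / (k - 1)) := by
      rw [← Real.mul_rpow (by norm_num) (by positivity), hs]
      congr 1
      ring
    have hθ0 : 0 < θ - 1 := by linarith
    calc _ ≤ 8 * (B * s ^ 2 * (θ * ((2 * A) ^ (2 - k) * s ^ ((2 - k) / (k - 1))) / (θ - 1)) +
          3 * A * s ^ (k / (k - 1))) := by
          gcongr
          exact hgeom.trans (by gcongr)
      _ = 8 * (B * (θ * (2 * A) ^ (2 - k) / (θ - 1)) * (s ^ 2 * s ^ ((2 - k) / (k - 1))) +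
          3 * A * s ^ (k / (k - 1))) := by ring
      _ = _ := by rw [hexp, hrate, hs6]; ring
  · have hmin : min (2 : ℝ) 3 = 2 := min_eq_left (by norm_num)
    rw [hmin]
    refine ⟨8 * (36 * B + 1) * (2 * (Real.log (A * 6) + 1) + 1),
      by have : 0 < Real.log (A * 6) := Real.log_pos (by linarith)
         positivity, fun σ ε r hσ hr hr1 h => ?_⟩
    refine (sum_allocation_le hB h _).trans ?_
    set I := numRegions A 2 σ ε with hI
    have hI1 := numRegions_lt hA hk hσ hr hr1 h
    have hX := one_le_cutoff_ratio hA hk hr hr1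
    have hL : 0 ≤ Real.log (A * 6) := Real.log_nonneg (by linarith)
    have hlp := one_le_logPlus (1 / r)
    have hlp2 : Real.log (1 / r) ≤ logPlus (1 / r) := le_max_right _ _
    have hI2 : (I : ℝ) ≤ (2 * (Real.log (A * 6) + 1) + 1) * logPlus (1 / r) := by
      have h1 := logb_two_le hX
      have h2 : A * (6 / r) ^ (1 / ((2 : ℝ) - 1)) = A * 6 * (1 / r) := by
        norm_num
        ring
      rw [h2] at h1 hI1
      rw [Real.log_mul (by positivity) (by positivity)] at h1
      nlinarith
    have hsum : ∑ j ∈ Finset.range I, ((2 : ℝ) ^ ((2 : ℝ) - 2)) ^ (j + 1) = I := by simp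
    rw [hsum]
    have hr2 : 1 ≤ 1 / r ^ 2 := by
      rw [one_le_div (by positivity)]
      exact pow_le_one₀ hr.le hr1.le
    have hrate : refinementRate 2 r = 1 / r ^ 2 * logPlus (1 / r) := by
      rw [refinementRate, if_neg (by norm_num), if_pos rfl]
    have hI0 : (0 : ℝ) ≤ I := Nat.cast_nonneg I
    calc _ = 8 * (36 * B * (1 / r ^ 2) * I + I) := by field_simp; norm_num
      _ ≤ 8 * (36 * B * (1 / r ^ 2) * I + 1 / r ^ 2 * I) := by
          gcongr
          exact le_mul_of_one_le_left hI0 hr2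
      _ = 8 * (36 * B + 1) * (1 / r ^ 2) * I := by ring
      _ ≤ 8 * (36 * B + 1) * (1 / r ^ 2) *
          ((2 * (Real.log (A * 6) + 1) + 1) * logPlus (1 / r)) := by gcongr
      _ = _ := by rw [hrate]; ring
  · set p := min k 3 with hpdef
    have hp2 : 2 < p := lt_min hk2 (by norm_num)
    set θ : ℝ := 2 ^ (2 - p) with hθ
    have hθ0 : 0 < θ := by positivity
    have hθ1 : θ < 1 := Real.rpow_lt_one_of_one_lt_of_neg (by norm_num) (by linarith)
    have hθ2 : 0 < 1 - θ := by linarith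
    refine ⟨8 * (B * (1 / (1 - θ)) + 3 * A) * 36, by positivity, fun σ ε r hσ hr hr1 h => ?_⟩
    refine (sum_allocation_le hB h _).trans ?_
    set s := 6 / r with hs
    have hs1 : 1 ≤ s := (one_le_div hr).2 (by linarith)
    have hs0 : 0 < s := by linarith
    set I := numRegions A p σ ε with hI
    have hI1 := numRegions_le (p := p) hA (by linarith) hσ hr hr1 h
    have hI2 : (I : ℝ) ≤ 3 * A * s ^ 2 := by
      refine hI1.trans ?_
      rw [← mul_assoc, ← Real.rpow_natCast]
      refine mul_le_mul_of_nonneg_left (Real.rpow_le_rpow_of_exponent_le hs1 ?_) (by positivity)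
      rw [div_le_iff₀ (by linarith)]
      push_cast
      linarith
    have hgeom : ∑ j ∈ Finset.range I, θ ^ (j + 1) ≤ 1 / (1 - θ) := by
      rw [le_div_iff₀ hθ2]
      have h1 := geom_sum_mul θ I
      have h2 : ∑ j ∈ Finset.range I, θ ^ (j + 1) = θ * ∑ j ∈ Finset.range I, θ ^ j := by
        rw [Finset.mul_sum]
        exact Finset.sum_congr rfl fun j _ => by ring
      have h3 : 0 ≤ θ ^ I := by positivity
      rw [h2]
      nlinarith
    have hrate : refinementRate k r = 1 / r ^ 2 := by rw [refinementRate, if_pos hk2]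
    calc _ ≤ 8 * (B * s ^ 2 * (1 / (1 - θ)) + 3 * A * s ^ 2) := by gcongr
      _ = _ := by rw [hrate, hs]; ring

theorem exists_samples_le {k A B : ℝ} (hk : 1 < k) (hA : 1 < A) (hB : 0 < B) :
    ∃ C : ℝ, 0 < C ∧ ∀ lam σmin σmax r δ : ℝ, 0 < σmin → σmin ≤ σmax → σmax ≤ lam →
      0 < r → r < 1 → 0 < δ → δ < 1 → ∀ ω,
        ((scaleAdaptiveEstimator localizer A B k lam σmin σmax r δ).samples ω : ℝ) ≤
          C * scaleAdaptiveComplexity k lam σmin σmax r δ := by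
  obtain ⟨Cb, hCb, hbase⟩ := exists_base_samples_le hk hA hB
  refine ⟨4 * (6 * (65539 * 361) + 41 * Cb), by positivity,
    fun lam σmin σmax r δ h0 h1 h2 hr hr1 hδ hδ1 ω => ?_⟩
  have hmax : 0 < σmax := by linarith
  have hlam : 0 < lam := by linarith
  set T := lastIndex σmin σmax with hT
  set Λ := logPlus (σmax / σmin) with hΛ
  set Γ := logPlus (Λ / δ) with hΓ
  set S := refinementRate k r with hS
  set M := Real.log (lam / Real.sqrt (σmin * σmax)) with hM
  have hΛ1 : 1 ≤ Λ := one_le_logPlus _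
  have hΓ1 : 1 ≤ Γ := one_le_logPlus _
  have hS1 : 1 ≤ S := one_le_refinementRate hk hr hr1
  have hR : 1 ≤ σmax / σmin := (one_le_div h0).2 h1
  have hRlog : Real.log (σmax / σmin) ≤ Λ := le_max_right _ _
  have hRlog0 : 0 ≤ Real.log (σmax / σmin) := Real.log_nonneg hR
  -- This shows that M is nonnegative and that 2 M dominates log(lam / σmax) + log(σmax / σmin),
  -- hence, up to 1, the localization cost at every guess.
  have hMeq : 2 * M = 2 * Real.log (lam / σmax) + Real.log (σmax / σmin) := by
    rw [hM, Real.log_div hlam.ne' (by positivity), Real.log_sqrt (by positivity),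
      Real.log_mul h0.ne' hmax.ne', Real.log_div hlam.ne' hmax.ne', Real.log_div hmax.ne' h0.ne']
    ring
  have hlm0 : 0 ≤ Real.log (lam / σmax) := Real.log_nonneg ((one_le_div hmax).2 h2)
  have hM0 : 0 ≤ M := by linarith
  have hTlt : (T : ℝ) < Real.logb 2 (σmax / σmin) + 1 :=
    Nat.ceil_lt_add_one (Real.logb_nonneg (by norm_num) hR)
  have hT4 : (T : ℝ) + 1 ≤ 4 * Λ := by
    have := logb_two_le hR
    linarith
  have hTlog : (T : ℝ) * Real.log 2 ≤ Real.log (σmax / σmin) + 1 := by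
    have hl2 : 0 < Real.log 2 := Real.log_pos (by norm_num)
    have hl1 : Real.log 2 ≤ 1 := by
      have := Real.log_two_lt_d9
      linarith
    have h3 : Real.logb 2 (σmax / σmin) * Real.log 2 = Real.log (σmax / σmin) := by
      rw [Real.logb]
      field_simp
    nlinarith
  set δ' := δ / (T + 1) with hδ'def
  have hδ' : 0 < δ' := by positivity
  have hδ1' : δ' < 1 := by
    rw [hδ'def, div_lt_one (by positivity)]
    have : (0 : ℝ) ≤ T := Nat.cast_nonneg T
    linarith
  -- Splitting δ over T + 1 ≤ 4 Λ rounds only adds log(4 Λ), which is the inner logarithm of the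
  -- bound.
  have hlogδ : Real.log (1 / δ') ≤ 4 * Γ := by
    have h3 : 1 / δ' ≤ 4 * (Λ / δ) := by
      rw [hδ'def, one_div_div, mul_div_assoc']
      gcongr
    calc Real.log (1 / δ') ≤ Real.log (4 * (Λ / δ)) := Real.log_le_log (by positivity) h3
      _ = Real.log 4 + Real.log (Λ / δ) := Real.log_mul (by norm_num) (by positivity)
      _ ≤ 3 + Γ := add_le_add (by
          have := Real.log_le_sub_one_of_pos (show (0 : ℝ) < 4 by norm_num)
          linarith) (le_max_right _ _)
      _ ≤ 4 * Γ := by linarith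
  have hreps : (⌈8 * Real.log (2 / δ')⌉₊ : ℝ) ≤ 41 * Γ := by
    have h3 : Real.log (2 / δ') = Real.log 2 + Real.log (1 / δ') := by
      rw [← Real.log_mul (by norm_num) (by positivity)]
      congr 1
      ring
    have h4 : 0 ≤ Real.log (1 / δ') := Real.log_nonneg ((one_le_div hδ').2 hδ1'.le)
    have h5 := Real.log_two_lt_d9
    have h6 := half_le_log_two
    have h7 := (Nat.ceil_lt_add_one (a := 8 * Real.log (2 / δ')) (by rw [h3]; positivity)).le
    rw [h3] at h7 ⊢
    linarith
  -- The cost of one round: localization and base estimates. Additive constants are absorbed because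
  -- S and Γ are at least 1.
  set X : ℝ := (6 * (65539 * 361) + 41 * Cb) * (S * Γ + M) with hX
  have hX0 : 0 ≤ X := by positivity
  have hround : ∀ i < 0 + (T + 1), (meanEstimator localizer A B k lam (guess σmax i)
      (r * guess σmax i / 6) δ').UsesAtMost ⌊X⌋₊ := by
    intro i hi
    refine (usesAtMost_meanEstimator A B k lam (guess σmax i) (r * guess σmax i / 6) δ').mono ?_
    apply Nat.le_floor
    have hg := guess_pos hmax i
    have hglam : guess σmax i ≤ lam :=
      (guess_antitone hmax (Nat.zero_le i)).trans (by simpa [guess] using h2)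
    have hb := hbase (guess σmax i) (r * guess σmax i / 6) r hg hr hr1 (by field_simp)
    have hloc := locSteps_le hg hglam hδ' hδ1'
    have hlogg : Real.log (lam / guess σmax i) ≤ 2 * M + 1 := by
      have h3 : lam / guess σmax i = lam / σmax * 2 ^ i := by
        rw [guess]
        field_simp
      rw [h3, Real.log_mul (by positivity) (by positivity), Real.log_pow]
      have h4 : (i : ℝ) ≤ T := Nat.cast_le.2 (by omega)
      have h5 : (i : ℝ) * Real.log 2 ≤ T * Real.log 2 :=
        mul_le_mul_of_nonneg_right h4 (Real.log_nonneg (by norm_num))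
      linarith
    rw [Nat.cast_add, Nat.cast_mul, Nat.cast_mul]
    have hSΓ : Γ ≤ S * Γ := le_mul_of_one_le_left (by linarith) hS1
    have hprod : (⌈8 * Real.log (2 / δ')⌉₊ : ℝ) *
        ((∑ j ∈ Finset.range (numRegions A (min k 3) (guess σmax i) (r * guess σmax i / 6)),
          8 * allocation B (min k 3) (guess σmax i) (r * guess σmax i / 6) (j + 1) : ℕ) : ℝ) ≤
        41 * Γ * (Cb * S) :=
      mul_le_mul hreps hb (Nat.cast_nonneg _) (by positivity)
    have hfirst : ((65539 : ℕ) : ℝ) * (locSteps lam (guess σmax i) δ' : ℝ) ≤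
        65539 * 361 * (6 * (S * Γ) + 2 * M) := by
      push_cast
      linarith
    have hCM : 0 ≤ Cb * M := by positivity
    have hXeq : X = 65539 * 361 * (6 * (S * Γ) + 2 * M) + 41 * Γ * (Cb * S) +
        (65539 * 361 * 4 * M + 41 * (Cb * M)) := by rw [hX]; ring
    rw [hXeq]
    linarith
  have htotal := usesAtMost_gridLoop (fun i => r * guess σmax i / 6) hround [] 0 ω
  have htotal' : ((scaleAdaptiveEstimator localizer A B k lam σmin σmax r δ).samples ω : ℝ) ≤
      (((T + 1) * ⌊X⌋₊ : ℕ) : ℝ) := Nat.cast_le.2 htotal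
  refine htotal'.trans ?_
  push_cast
  calc ((T : ℝ) + 1) * ⌊X⌋₊ ≤ 4 * Λ * X :=
        mul_le_mul hT4 (Nat.floor_le hX0) (Nat.cast_nonneg _) (by linarith)
    _ = _ := by rw [scaleAdaptiveComplexity, hX]; ring

theorem theorem5 :
    ∃ loc : ℝ → ℝ → ℝ → Protocol (ℝ × ℝ), IsLocalizer loc ∧
      ∀ k : ℝ, 1 < k → ∃ A B C : ℝ, 0 < A ∧ 0 < B ∧ 0 < C ∧
        ∀ lam σmin σmax r δ : ℝ, 0 < σmin → σmin ≤ σmax → σmax ≤ lam →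
          0 < r → r < 1 → 0 < δ → δ < 1 →
          (∀ ω, ((scaleAdaptiveEstimator loc A B k lam σmin σmax r δ).samples ω : ℝ) ≤
            C * scaleAdaptiveComplexity k lam σmin σmax r δ) ∧
          ∀ σtrue ∈ Set.Icc σmin σmax,
            IsPAC (scaleAdaptiveEstimator loc A B k lam σmin σmax r δ) (r * σtrue) δ
              (InFamily k lam σtrue) := by
  refine ⟨localizer, isLocalizer_localizer, fun k hk => ?_⟩
  have hp : 1 < min k 3 := lt_min hk (by norm_num)
  have hA := one_lt_cutoffConst hp
  obtain ⟨C, hC, hsamples⟩ := exists_samples_le hk hA (B := 200000) (by norm_num)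
  exact ⟨cutoffConst (min k 3), 200000, C, by linarith, by norm_num, hC,
    fun lam σmin σmax r δ h0 h1 h2 hr hr1 hδ hδ1 =>
      ⟨hsamples lam σmin σmax r δ h0 h1 h2 hr hr1 hδ hδ1, fun σ hσ =>
        isPAC_scaleAdaptiveEstimator hk h0 hσ h2 hr hr1 hδ hδ1⟩⟩
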